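/- Let $\varphi_0,\varphi_1,\dots$ be the standard enumeration of the partial computable functions $\mathbb N\rightharpoonup\mathbb N$, and fix the standard computable pairing $\langle\cdot,\cdot\rangle$ on $\mathbb N$. If $\varphi_e$ is total and $(a,b)\mapsto\varphi_e(\langle a,b\rangle)$ is the characteristic function of (the strict relation $<_e$ of) a linear ordering of $\mathbb N$, let $\mathcal A_e=(\mathbb N,<_e)$ be this linear ordering. A structure $\mathcal A$ is *ultrahomogeneous* if every isomorphism between finitely generated substructures of $\mathcal A$ extends to an automorphism of $\mathcal A$. It is *weakly ultrahomogeneous* if there is a finite set $E\subseteq\mathcal A$ such that every isomorphism between finitely generated substructures of $\mathcal A$ that contain $E$, fixing every element of $E$, extends to an automorphism of $\mathcal A$. Put $$LIN=\{e:\mathcal A_e\text{ is a linear ordering}\},$$ $$UHL=\{e:\mathcal A_e\text{ is an ultrahomogeneous linear ordering}\},$$ $$WUL=\{e:\mathcal A_e\text{ is a weakly ultrahomogeneous linear ordering}\}.$$ For a class $\Gamma$ of subsets of $\mathbb N$, a set $B\subseteq\mathbb N$ is *$\Gamma$ complete* if $B\in\Gamma$ and for every $A\in\Gamma$ there is a computable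 $f:\mathbb N\to\mathbb N$ with $i\in A\iff f(i)\in B$ for all $i$. It is *$\Gamma$ complete relative to $D$* if $B=C\cap D$ for some $C\in\Gamma$ and for every $A\in\Gamma$ there is a computable $f:\mathbb N\to\mathbb N$ with $f(i)\in D$ and $i\in A\iff f(i)\in B$ for all $i$. **Theorem.** (a) The index set $UHL$ is $\Pi^0_2$ complete, and in fact $\Pi^0_2$ complete relative to $LIN$. (b) The index set $WUL$ is $\Sigma^0_3$ complete, and in fact $\Sigma^0_3$ complete relative to $LIN$. -/

import Mathlib

open FirstOrder

/-- `A` is `Π⁰₂`: it has the form `{n | ∀ x, ∃ y, R n x y}` with `R` computable. -/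
def IsPi02 (A : Set ℕ) : Prop :=
  ∃ R : ℕ × ℕ × ℕ → Prop, ComputablePred R ∧ ∀ n, n ∈ A ↔ ∀ x, ∃ y, R (n, x, y)

/-- `A` is `Σ⁰₃`: it has the form `{n | ∃ x, ∀ y, ∃ z, R n x y z}` with `R` computable. -/
def IsSigma03 (A : Set ℕ) : Prop :=
  ∃ R : ℕ × ℕ × ℕ × ℕ → Prop, ComputablePred R ∧
    ∀ n, n ∈ A ↔ ∃ x, ∀ y, ∃ z, R (n, x, y, z)

/-- `B` is `Γ` complete: `B` is in `Γ`, and every set in `Γ` is many-one reducible to `B`. -/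
def IsCompleteFor (Γ : Set ℕ → Prop) (B : Set ℕ) : Prop :=
  Γ B ∧ ∀ A : Set ℕ, Γ A → ∃ f : ℕ → ℕ, Computable f ∧ ∀ i, i ∈ A ↔ f i ∈ B

/-- `B` is `Γ` complete relative to `D`: within `D` the set `B` is cut out by a set in `Γ`, and
every set in `Γ` is many-one reducible to `B` by a computable function all of whose values lie
in `D`. -/
def IsCompleteRelativeTo (Γ : Set ℕ → Prop) (B D : Set ℕ) : Prop :=
  (∃ C : Set ℕ, Γ C ∧ B = C ∩ D) ∧
    ∀ A : Set ℕ, Γ A → ∃ f : ℕ → ℕ, Computable f ∧ (∀ i, f i ∈ D) ∧ ∀ i, i ∈ A ↔ f i ∈ B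

/-- The standard enumeration `φ_0, φ_1, …` of the unary partial computable functions. -/
def phi (e : ℕ) : ℕ →. ℕ :=
  Nat.Partrec.Code.eval (Denumerable.ofNat Nat.Partrec.Code e)

open Classical in
/-- `φ_e` is total and is the characteristic function of the strict order relation `<` of the
linear order `lo` on `ℕ` (pairs are coded by `Nat.pair`). That is, `𝒜_e` is the linear order
`(ω, <)` given by `lo`. -/
def IsIndexOf (e : ℕ) (lo : LinearOrder ℕ) : Prop :=
  ∀ a b : ℕ, phi e (Nat.pair a b) = Part.some (if lo.lt a b then 1 else 0)

/-- The linear order `lo` on `ℕ`, as a first-order structure in the language of orders. -/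
abbrev orderStr (lo : LinearOrder ℕ) : Language.order.Structure ℕ :=
  @Language.orderStructure ℕ lo.toLE

/-- `M` is weakly ultrahomogeneous: there is a finite set `E` such that every isomorphism between
finitely generated substructures that contain `E`, fixing `E` pointwise, extends to an
automorphism of `M`. -/
def IsWeaklyUltrahomogeneous (L : Language) (M : Type*) [L.Structure M] : Prop :=
  ∃ E : Set M, E.Finite ∧
    ∀ S T : L.Substructure M, S.FG → T.FG → E ⊆ (S : Set M) → E ⊆ (T : Set M) →
      ∀ f : S ≃[L] T, (∀ x : S, (x : M) ∈ E → ((f x : T) : M) = x) →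
        ∃ g : M ≃[L] M, ∀ x : S, g x = ((f x : T) : M)

/-- Indices of computable linear orders with universe `ℕ`. -/
def LIN : Set ℕ := {e | ∃ lo : LinearOrder ℕ, IsIndexOf e lo}

/-- Indices of computable ultrahomogeneous linear orders. -/
def UHL : Set ℕ :=
  {e | ∃ lo : LinearOrder ℕ, IsIndexOf e lo ∧
    @Language.IsUltrahomogeneous Language.order ℕ (orderStr lo)}

/-- Indices of computable weakly ultrahomogeneous linear orders. -/
def WUL : Set ℕ :=
  {e | ∃ lo : LinearOrder ℕ, IsIndexOf e lo ∧
    @IsWeaklyUltrahomogeneous Language.order ℕ (orderStr lo)}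

/-! Finitely generated substructures of an order are finite subsets, so both notions of homogeneity
concern strictly monotone maps between finite sets. A finite parameter set `E` cuts the rest of the
order into components. Homogeneity over `E` forces every component to be a single point or dense
without endpoints; adding the finitely many single points to `E` gives `LocallyDenseOff`. For
countable orders the converse is a back-and-forth argument. So a countable order is weakly
ultrahomogeneous iff it is locally dense off some finite set (`isWeaklyUltrahomogeneous_iff`), and,
if it has two points, ultrahomogeneous iff it is locally dense off the empty set
(`isUltrahomogeneous_iff`).

Upper bounds: being the index of a linear order that is locally dense off a given finite list is an
∀∃ condition (`forall_exists_denseOrderWitness_iff`). This gives Π⁰₂ for the empty list, and Σ⁰₃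
once the list is quantified existentially.

Hardness: for computable `R`, an order is built as an ω-sum of blocks. Block `x` consists of
sections `0, 1, 2, …`, each a copy of ℚ, closed by a top point from section 1 on, and finally of one
end point. Section `i` is present only if all requirements `∃ z, R (n, x, y, z)` with `y < i - 1`
hold. If all sections are present, the end point is a limit from below and nothing in the block is
adjacent; otherwise the last top and the end point are adjacent. Thus the order is ultrahomogeneous
iff no block is bad, and weakly ultrahomogeneous iff finitely many are (`exists_reduction`). Π⁰₂
sets reduce directly; for Σ⁰₃ sets the requirements are first made monotone in `x`, so that the bad
blocks are all blocks or only finitely many. -/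

/-- Every point outside `E` has points on both sides and is not adjacent to any other point. -/
def LocallyDenseOff {α : Type*} (r : α → α → Prop) (E : Set α) : Prop :=
  ∀ m ∉ E, (∃ d, r d m) ∧ (∃ d, r m d) ∧ (∀ u, r u m → ∃ c, r u c ∧ r c m) ∧
    ∀ u, r m u → ∃ c, r m c ∧ r c u

/-! ### Back and forth in locally dense orders -/

section Order

variable {α : Type*} [LinearOrder α]

open Order

lemma LocallyDenseOff.exists_between_finsets_of_max {E : Set α}
    (hE : LocallyDenseOff (· < ·) E) {lo hi : Finset α} (h : ∀ x ∈ lo, ∀ y ∈ hi, x < y)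
    {m : α} (hm : m ∈ lo) (hmax : ∀ x ∈ lo, x ≤ m) (hmE : m ∉ E) :
    ∃ b, (∀ x ∈ lo, x < b) ∧ ∀ y ∈ hi, b < y := by
  obtain ⟨-, ⟨d, hd⟩, -, hup⟩ := hE m hmE
  rcases hi.eq_empty_or_nonempty with rfl | hne
  · exact ⟨d, fun x hx => (hmax x hx).trans_lt hd, by simp⟩
  · obtain ⟨c, hc, hc'⟩ := hup _ (h m hm _ (hi.min'_mem hne))
    exact ⟨c, fun x hx => (hmax x hx).trans_lt hc, fun y hy => hc'.trans_le (hi.min'_le y hy)⟩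

lemma LocallyDenseOff.exists_between_finsets_of_min {E : Set α}
    (hE : LocallyDenseOff (· < ·) E) {lo hi : Finset α} (h : ∀ x ∈ lo, ∀ y ∈ hi, x < y)
    {m : α} (hm : m ∈ hi) (hmin : ∀ x ∈ hi, m ≤ x) (hmE : m ∉ E) :
    ∃ b, (∀ x ∈ lo, x < b) ∧ ∀ y ∈ hi, b < y := by
  obtain ⟨⟨d, hd⟩, -, hdown, -⟩ := hE m hmE
  rcases lo.eq_empty_or_nonempty with rfl | hne
  · exact ⟨d, by simp, fun x hx => hd.trans_le (hmin x hx)⟩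
  · obtain ⟨c, hc, hc'⟩ := hdown _ (h _ (lo.max'_mem hne) m hm)
    exact ⟨c, fun y hy => (lo.le_max' y hy).trans_lt hc, fun x hx => hc'.trans_le (hmin x hx)⟩

/-- If the image nearest to the gap, on either side, is outside `E`, local density at that point
fills the gap. Otherwise the nearest images lie in `E`, hence are fixed, and `a` itself fits. -/
lemma LocallyDenseOff.exists_across {E : Set α} (hE : LocallyDenseOff (· < ·) E)
    (f : PartialIso α α) (hf : ∀ e ∈ E, (e, e) ∈ f.val) (a : α) :
    ∃ b, ∀ p ∈ f.val, cmp p.1 a = cmp p.2 b := by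
  by_cases h : ∃ b, (a, b) ∈ f.val
  · obtain ⟨b, hb⟩ := h
    exact ⟨b, fun p hp => f.prop _ hp _ hb⟩
  set lo := {p ∈ f.val | p.1 < a}.image Prod.snd with hlo
  set hi := {p ∈ f.val | a < p.1}.image Prod.snd with hhi
  have hlt : ∀ x ∈ lo, ∀ y ∈ hi, x < y := by
    intro x hx y hy
    simp only [hlo, hhi, Finset.mem_image, Finset.mem_filter] at hx hy
    obtain ⟨p, hp, rfl⟩ := hx
    obtain ⟨q, hq, rfl⟩ := hy
    rw [← lt_iff_lt_of_cmp_eq_cmp (f.prop _ hp.1 _ hq.1)]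
    exact hp.2.trans hq.2
  -- The pair `(p.2, p.2)` belongs to `f` as well, and `f` is injective.
  have hfix : ∀ p ∈ f.val, p.2 ∈ E → p.1 = p.2 := fun p hp hpE =>
    (eq_iff_eq_of_cmp_eq_cmp (f.prop _ hp _ (hf _ hpE))).2 rfl
  have key : ∃ b, (∀ x ∈ lo, x < b) ∧ ∀ y ∈ hi, b < y := by
    by_cases h1 : ∃ m ∈ lo, (∀ x ∈ lo, x ≤ m) ∧ m ∉ E
    · obtain ⟨m, hm, hmax, hmE⟩ := h1
      exact hE.exists_between_finsets_of_max hlt hm hmax hmE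
    by_cases h2 : ∃ m ∈ hi, (∀ x ∈ hi, m ≤ x) ∧ m ∉ E
    · obtain ⟨m, hm, hmin, hmE⟩ := h2
      exact hE.exists_between_finsets_of_min hlt hm hmin hmE
    push Not at h1 h2
    refine ⟨a, fun x hx => ?_, fun x hx => ?_⟩
    · have hne : lo.Nonempty := ⟨x, hx⟩
      have hmE := h1 _ (lo.max'_mem hne) fun y hy => lo.le_max' y hy
      obtain ⟨p, hp, hpe⟩ := Finset.mem_image.1 (lo.max'_mem hne)
      rw [Finset.mem_filter] at hp
      refine (lo.le_max' x hx).trans_lt ?_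
      rw [← hpe] at hmE ⊢
      exact hfix p hp.1 hmE ▸ hp.2
    · have hne : hi.Nonempty := ⟨x, hx⟩
      have hmE := h2 _ (hi.min'_mem hne) fun y hy => hi.min'_le y hy
      obtain ⟨p, hp, hpe⟩ := Finset.mem_image.1 (hi.min'_mem hne)
      rw [Finset.mem_filter] at hp
      refine lt_of_lt_of_le ?_ (hi.min'_le x hx)
      rw [← hpe] at hmE ⊢
      exact hfix p hp.1 hmE ▸ hp.2
  obtain ⟨b, hb⟩ := key
  refine ⟨b, fun p hp => ?_⟩
  rcases lt_trichotomy p.1 a with hpa | hpa | hpa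
  · rw [(cmp_eq_lt_iff _ _).2 hpa, (cmp_eq_lt_iff _ _).2
      (hb.1 _ (Finset.mem_image.2 ⟨p, Finset.mem_filter.2 ⟨hp, hpa⟩, rfl⟩))]
  · exact (h ⟨p.2, hpa ▸ hp⟩).elim
  · rw [(cmp_eq_gt_iff _ _).2 hpa, (cmp_eq_gt_iff _ _).2
      (hb.2 _ (Finset.mem_image.2 ⟨p, Finset.mem_filter.2 ⟨hp, hpa⟩, rfl⟩))]

lemma LocallyDenseOff.exists_extend_left {E : Set α} (hE : LocallyDenseOff (· < ·) E)
    (f : PartialIso α α) (hf : ∀ e ∈ E, (e, e) ∈ f.val) (a : α) :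
    ∃ g : PartialIso α α, f ≤ g ∧ ∃ b, (a, b) ∈ g.val := by
  obtain ⟨b, hb⟩ := hE.exists_across f hf a
  refine ⟨⟨insert (a, b) f.val, fun p hp q hq => ?_⟩, Finset.subset_insert _ _, b,
    Finset.mem_insert_self _ _⟩
  rw [Finset.mem_insert] at hp hq
  rcases hp with rfl | hp <;> rcases hq with rfl | hq
  · simp
  · rw [cmp_eq_cmp_symm]
    exact hb _ hq
  · exact hb _ hp
  · exact f.prop _ hp _ hq

lemma PartialIso.mem_comm {f : PartialIso α α} {a b : α} :
    (a, b) ∈ f.comm.val ↔ (b, a) ∈ f.val := by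
  change (a, b) ∈ f.val.image _ ↔ _
  simp

lemma LocallyDenseOff.exists_extend_right {E : Set α} (hE : LocallyDenseOff (· < ·) E)
    (f : PartialIso α α) (hf : ∀ e ∈ E, (e, e) ∈ f.val) (b : α) :
    ∃ g : PartialIso α α, f ≤ g ∧ ∃ a, (a, b) ∈ g.val := by
  obtain ⟨g, hg, a, ha⟩ := hE.exists_extend_left f.comm
    (fun e he => PartialIso.mem_comm.2 (hf e he)) b
  exact ⟨g.comm, fun p hp => PartialIso.mem_comm.2 (hg (PartialIso.mem_comm.2 hp)), a,
    PartialIso.mem_comm.2 ha⟩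

/-- Back and forth: a finite partial isomorphism fixing `E` extends to an automorphism. -/
theorem LocallyDenseOff.exists_orderIso [Countable α] {E : Set α}
    (hE : LocallyDenseOff (· < ·) E) (f : PartialIso α α) (hf : ∀ e ∈ E, (e, e) ∈ f.val) :
    ∃ g : α ≃o α, ∀ p ∈ f.val, g p.1 = p.2 := by
  cases nonempty_encodable α
  -- Only extensions of `f` are admitted, so each of them still fixes `E` and can be extended
  -- further.
  let D : α ⊕ α → Cofinal {g : PartialIso α α // f ≤ g} := Sum.elim
    (fun a => ⟨{g | ∃ b, (a, b) ∈ g.1.val}, fun g => by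
      obtain ⟨h, hh, b, hb⟩ := hE.exists_extend_left g.1 (fun e he => g.2 (hf e he)) a
      exact ⟨⟨h, g.2.trans hh⟩, ⟨b, hb⟩, hh⟩⟩)
    (fun b => ⟨{g | ∃ a, (a, b) ∈ g.1.val}, fun g => by
      obtain ⟨h, hh, a, ha⟩ := hE.exists_extend_right g.1 (fun e he => g.2 (hf e he)) b
      exact ⟨⟨h, g.2.trans hh⟩, ⟨a, ha⟩, hh⟩⟩)
  let I : Ideal {g : PartialIso α α // f ≤ g} := idealOfCofinals ⟨f, le_rfl⟩ D
  have hF : ∀ a, ∃ b, ∃ g ∈ I, (a, b) ∈ g.1.val := fun a => by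
    obtain ⟨g, ⟨b, hb⟩, hg⟩ := cofinal_meets_idealOfCofinals ⟨f, le_rfl⟩ D (Sum.inl a)
    exact ⟨b, g, hg, hb⟩
  have hG : ∀ b, ∃ a, ∃ g ∈ I, (a, b) ∈ g.1.val := fun b => by
    obtain ⟨g, ⟨a, ha⟩, hg⟩ := cofinal_meets_idealOfCofinals ⟨f, le_rfl⟩ D (Sum.inr b)
    exact ⟨a, g, hg, ha⟩
  choose F hF using hF
  choose G hG using hG
  have hcmp : ∀ a b a' b', (∃ g ∈ I, (a, b) ∈ g.1.val) → (∃ g ∈ I, (a', b') ∈ g.1.val) →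
      cmp a a' = cmp b b' := by
    rintro a b a' b' ⟨g, hg, h⟩ ⟨g', hg', h'⟩
    obtain ⟨m, _, hm, hm'⟩ := I.directed _ hg _ hg'
    exact m.1.prop (a, b) (hm h) (a', b') (hm' h')
  refine ⟨OrderIso.ofCmpEqCmp F G fun a b => hcmp _ _ _ _ (hF a) (hG b), fun p hp => ?_⟩
  exact (eq_iff_eq_of_cmp_eq_cmp (hcmp p.1 _ p.1 p.2 (hF p.1)
    ⟨⟨f, le_rfl⟩, mem_idealOfCofinals _ _, hp⟩)).1 rfl

/-! ### Homogeneity over a finite set and the components of its complement -/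

/-- Every strictly monotone map between finite sets that contain `E`, fixing `E` pointwise,
extends to an order automorphism. -/
def OrderHomogeneousOver (E : Set α) : Prop :=
  ∀ (S : Set α) (φ : α → α), S.Finite → E ⊆ S → StrictMonoOn φ S → (∀ e ∈ E, φ e = e) →
    ∃ g : α ≃o α, ∀ x ∈ S, g x = φ x

theorem LocallyDenseOff.orderHomogeneousOver [Countable α] {E : Set α}
    (hE : LocallyDenseOff (· < ·) E) : OrderHomogeneousOver E := by
  intro S φ hS hES hφ hfix
  let f : PartialIso α α := ⟨hS.toFinset.image fun x => (x, φ x), by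
    intro p hp q hq
    simp only [Finset.mem_image, Set.Finite.mem_toFinset] at hp hq
    obtain ⟨x, hx, rfl⟩ := hp
    obtain ⟨y, hy, rfl⟩ := hq
    exact (hφ.cmp_map_eq hx hy).symm⟩
  have hmem : ∀ x ∈ S, (x, φ x) ∈ f.val := fun x hx =>
    Finset.mem_image.2 ⟨x, hS.mem_toFinset.2 hx, rfl⟩
  obtain ⟨g, hg⟩ := hE.exists_orderIso f fun e he => by
    have := hmem e (hES he)
    rwa [hfix e he] at this
  exact ⟨g, fun x hx => hg _ (hmem x hx)⟩

/-- Two points are in the same component of the complement of `E`. -/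
def SameCut (E : Set α) (a b : α) : Prop :=
  a ∉ E ∧ b ∉ E ∧ ∀ e ∈ E, e < a ↔ e < b

/-- Points may be moved freely inside their components, since this preserves their order relative to
`E`. The case `a = b` is allowed, to move a single point. -/
lemma OrderHomogeneousOver.exists_map_pair {E : Set α} (hE : E.Finite)
    (h : OrderHomogeneousOver E) {a b a' b' : α} (hab : a ≤ b) (hab' : a < b → a' < b')
    (heq : b = a → b' = a') (ha : SameCut E a a') (hb : SameCut E b b') :
    ∃ g : α ≃o α, (∀ e ∈ E, g e = e) ∧ g a = a' ∧ g b = b' := by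
  classical
  obtain ⟨haE, haE', ha⟩ := ha
  obtain ⟨hbE, hbE', hb⟩ := hb
  let φ : α → α := fun x => if x = a then a' else if x = b then b' else x
  have h1 : ∀ e ∈ E, φ e = e := fun e he => by
    have : e ≠ a := fun h => haE (h ▸ he)
    have : e ≠ b := fun h => hbE (h ▸ he)
    simp [φ, *]
  have h2 : φ a = a' := by simp [φ]
  have h3 : φ b = b' := by
    by_cases hba : b = a
    · simp [φ, hba, heq hba]
    · simp [φ, hba]
  have hgt : ∀ {c c' : α}, c ∉ E → c' ∉ E → (∀ e ∈ E, e < c ↔ e < c') →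
      ∀ e ∈ E, c < e → c' < e := fun {c c'} hc hc' hcc e he hlt =>
    lt_of_le_of_ne (not_lt.1 fun h => hlt.not_gt ((hcc e he).2 h)) fun h => hc' (h ▸ he)
  have hmono : StrictMonoOn φ (E ∪ {a, b}) := by
    rintro x (hx | rfl | rfl) y (hy | rfl | rfl) hxy
    · rwa [h1 x hx, h1 y hy]
    · rw [h1 x hx, h2]; exact (ha x hx).1 hxy
    · rw [h1 x hx, h3]; exact (hb x hx).1 hxy
    · rw [h1 y hy, h2]; exact hgt haE haE' ha y hy hxy
    · exact (lt_irrefl _ hxy).elim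
    · rw [h2, h3]; exact hab' hxy
    · rw [h1 y hy, h3]; exact hgt hbE hbE' hb y hy hxy
    · exact (hxy.not_ge hab).elim
    · exact (lt_irrefl _ hxy).elim
  obtain ⟨g, hg⟩ := h (E ∪ {a, b}) φ (hE.union (by simp)) Set.subset_union_left hmono h1
  exact ⟨g, fun e he => (hg e (Or.inl he)).trans (h1 e he), (hg a (by simp)).trans h2,
    (hg b (by simp)).trans h3⟩

/-- The points that are alone in their component of the complement of `E`. -/
def isolatedPoints (E : Set α) : Set α :=
  {m | ∀ u, SameCut E m u → u = m}

/-- An isolated point outside `E` is determined by the set of points of `E` below it. Points of `E`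
satisfy `isolatedPoints` vacuously, hence the difference. -/
lemma finite_isolatedPoints_diff {E : Set α} (hE : E.Finite) :
    (isolatedPoints E \ E).Finite := by
  refine Set.Finite.of_finite_image (f := fun a => {e | e ∈ E ∧ e < a})
    (hE.finite_subsets.subset ?_) ?_
  · rintro _ ⟨a, -, rfl⟩
    exact fun e he => he.1
  · rintro a ⟨ha, haE⟩ b ⟨hb, hbE⟩ hab
    refine hb _ ⟨hbE, haE, fun e he => ?_⟩
    have := Set.ext_iff.1 hab e
    simp only [Set.mem_ofPred_eq, he, true_and] at this
    exact this.symm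

lemma SameCut.symm {E : Set α} {a b : α} (h : SameCut E a b) : SameCut E b a :=
  ⟨h.2.1, h.1, fun e he => (h.2.2 e he).symm⟩

lemma SameCut.trans {E : Set α} {a b c : α} (h : SameCut E a b) (h' : SameCut E b c) :
    SameCut E a c :=
  ⟨h.1, h'.2.1, fun e he => (h.2.2 e he).trans (h'.2.2 e he)⟩

lemma SameCut.refl {E : Set α} {a : α} (h : a ∉ E) : SameCut E a a :=
  ⟨h, h, fun _ _ => Iff.rfl⟩

lemma SameCut.map {E : Set α} {a b : α} (h : SameCut E a b) {g : α ≃o α}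
    (hg : ∀ e ∈ E, g e = e) : SameCut E (g a) (g b) := by
  have hmem : ∀ x, x ∉ E → g x ∉ E := fun x hx hgx =>
    hx (g.injective (hg _ hgx) ▸ hgx)
  refine ⟨hmem a h.1, hmem b h.2.1, fun e he => ?_⟩
  rw [← hg e he, g.lt_iff_lt, g.lt_iff_lt]
  exact h.2.2 e he

/-- Between two points in different components lies a point of `E`. -/
lemma exists_mem_between {E : Set α} {a b : α} (ha : a ∉ E) (hb : b ∉ E) (hab : a < b)
    (h : ¬ SameCut E a b) : ∃ e ∈ E, a < e ∧ e < b := by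
  by_contra! hcon
  refine h ⟨ha, hb, fun e he => ⟨fun h => h.trans hab, fun h => ?_⟩⟩
  by_contra hea
  exact (hcon e he (lt_of_le_of_ne (not_lt.1 hea) fun h => ha (h ▸ he))).not_gt h

/-- The component of a non-isolated point contains some `a < b`. Automorphisms fixing `E` carry this
configuration to any other place in the component, which therefore has no endpoints and is dense.
Towards a point outside the component, a neighbour inside the component lies between. -/
theorem OrderHomogeneousOver.locallyDenseOff {E : Set α} (hE : E.Finite)
    (h : OrderHomogeneousOver E) : LocallyDenseOff (· < ·) (E ∪ isolatedPoints E) := by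
  intro m hm
  simp only [Set.mem_union, isolatedPoints, Set.mem_ofPred_eq, not_or, not_forall] at hm
  obtain ⟨hmE, u, hmu, hne⟩ := hm
  obtain ⟨a, b, hab, hma, hmb⟩ : ∃ a b, a < b ∧ SameCut E m a ∧ SameCut E m b := by
    rcases lt_or_gt_of_ne hne with h | h
    exacts [⟨u, m, h, hmu, .refl hmE⟩, ⟨m, u, h, .refl hmE, hmu⟩]
  have above : ∀ c, SameCut E m c → ∃ d, c < d ∧ SameCut E m d := by
    intro c hc
    obtain ⟨g, hg, hga, -⟩ := h.exists_map_pair hE (le_refl a)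
      (fun h => (lt_irrefl _ h).elim) (fun _ => rfl) (hma.symm.trans hc) (hma.symm.trans hc)
    exact ⟨g b, hga ▸ g.strictMono hab, hc.trans (hga ▸ (hma.symm.trans hmb).map hg)⟩
  have below : ∀ c, SameCut E m c → ∃ d, d < c ∧ SameCut E m d := by
    intro c hc
    obtain ⟨g, hg, hgb, -⟩ := h.exists_map_pair hE (le_refl b)
      (fun h => (lt_irrefl _ h).elim) (fun _ => rfl) (hmb.symm.trans hc) (hmb.symm.trans hc)
    exact ⟨g a, hgb ▸ g.strictMono hab, hc.trans (hgb ▸ (hmb.symm.trans hma).map hg)⟩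
  have dense : ∀ c d, SameCut E m c → SameCut E m d → c < d → ∃ e, c < e ∧ e < d := by
    intro c d hc hd hcd
    obtain ⟨x, hax, hx⟩ := below a hma
    -- The point `a` lies between `x` and `b`, so its image lies between `c` and `d`.
    obtain ⟨g, -, hgx, hgb⟩ := h.exists_map_pair hE (hax.trans hab).le (fun _ => hcd)
      (fun h => ((hax.trans hab).ne' h).elim) (hx.symm.trans hc) (hmb.symm.trans hd)
    exact ⟨g a, hgx ▸ g.strictMono hax, hgb ▸ g.strictMono hab⟩
  obtain ⟨d, hd, hmd⟩ := below m (.refl hmE)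
  obtain ⟨d', hd', hmd'⟩ := above m (.refl hmE)
  refine ⟨⟨d, hd⟩, ⟨d', hd'⟩, fun v hv => ?_, fun v hv => ?_⟩
  · by_cases hmv : SameCut E m v
    · exact dense v m hmv (.refl hmE) hv
    -- If `d ≤ v < m`, then `v` would be trapped in the common component of `d` and `m`.
    · refine ⟨d, not_le.1 fun hdv => ?_, hd⟩
      rcases em (v ∈ E) with hvE | hvE
      · rcases hdv.eq_or_lt with rfl | hlt
        · exact hmd.2.1 hvE
        · exact hlt.not_gt ((hmd.2.2 v hvE).1 hv)
      · obtain ⟨e, he, h1, h2⟩ := exists_mem_between hvE hmE hv fun h => hmv h.symm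
        exact (hdv.trans_lt h1).not_gt ((hmd.2.2 e he).1 h2)
  · by_cases hmv : SameCut E m v
    · exact dense m v (.refl hmE) hmv hv
    · refine ⟨d', hd', not_le.1 fun hdv => ?_⟩
      rcases em (v ∈ E) with hvE | hvE
      · rcases hdv.eq_or_lt with rfl | hlt
        · exact hmd'.2.1 hvE
        · exact hlt.not_gt (lt_of_not_ge fun h =>
            hv.not_gt ((hmd'.2.2 v hvE).2 hlt))
      · obtain ⟨e, he, h1, h2⟩ := exists_mem_between hmE hvE hv hmv
        exact h1.not_gt ((hmd'.2.2 e he).2 (h2.trans_le hdv))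

end Order

/-! ### From first-order homogeneity to local density -/

section Structure

open Language

variable {α : Type*} [LinearOrder α] [Language.order.Structure α]
  [Language.order.OrderedStructure α]

/-- Automorphisms of an order as a first-order structure are the order automorphisms. -/
def orderIsoOfEquiv (g : α ≃[Language.order] α) : α ≃o α :=
  ⟨g.toEquiv, fun {a b} => by
    have h := g.map_rel (leSymb : Language.order.Relations 2) ![a, b]
    rw [relMap_leSymb, relMap_leSymb] at h
    exact h⟩

/-- Order automorphisms are automorphisms of the order as a first-order structure. -/
def equivOfOrderIso (g : α ≃o α) : α ≃[Language.order] α where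
  toEquiv := g.toEquiv
  map_fun' := fun f => nomatch f
  map_rel' := fun {n} r x => by
    cases r
    exact (relMap_leSymb (L := Language.order) _).trans
      (g.map_rel_iff.trans (relMap_leSymb (L := Language.order) _).symm)

lemma strictMono_of_embedding {S : Language.order.Substructure α} (f : S ↪[Language.order] α)
    {x y : S} : (x : α) < y → f x < f y := by
  have h : f y ≤ f x ↔ (y : α) ≤ x := by
    have h := f.map_rel (leSymb : Language.order.Relations 2) ![y, x]
    rw [relMap_leSymb, relMap_leSymb] at h
    exact h
  exact fun hxy => not_le.1 fun hle => hxy.not_ge (h.1 hle)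

/-- A strictly monotone map on a set, as an isomorphism of substructures onto its image. -/
noncomputable def equivOfStrictMonoOn (S : Set α) (φ : α → α) (hφ : StrictMonoOn φ S) :
    Substructure.closure Language.order S ≃[Language.order]
      Substructure.closure Language.order (φ '' S) where
  toEquiv := ((Equiv.setCongr (Substructure.closure_eq_of_isRelational Language.order S)).trans
    (Equiv.Set.imageOfInjOn φ S hφ.injOn)).trans
    (Equiv.setCongr (Substructure.closure_eq_of_isRelational Language.order _)).symm
  map_fun' := fun f => nomatch f
  map_rel' := fun {n} r x => by
    cases r
    have hx : ∀ i, (x i : α) ∈ S := fun i => by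
      have := (x i).2
      rwa [← SetLike.mem_coe, Substructure.closure_eq_of_isRelational] at this
    exact (relMap_leSymb (L := Language.order) _).trans
      ((hφ.le_iff_le (hx 0) (hx 1)).trans
        (relMap_leSymb (L := Language.order) fun i => (x i : α)).symm)

lemma OrderHomogeneousOver.exists_equiv {E : Set α} (h : OrderHomogeneousOver E)
    {S : Language.order.Substructure α} (hS : S.FG) (hES : E ⊆ S) (f : S ↪[Language.order] α)
    (hf : ∀ x : S, (x : α) ∈ E → f x = x) :
    ∃ g : α ≃[Language.order] α, ∀ x : S, g x = f x := by
  classical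
  let φ : α → α := fun x => if hx : x ∈ S then f ⟨x, hx⟩ else x
  have hφ : ∀ x : S, φ x = f x := fun x => by simp [φ]
  have hfin : (S : Set α).Finite := Set.finite_coe_iff.1 hS.finite
  obtain ⟨g, hg⟩ := h S φ hfin hES (fun x hx y hy hxy => by
    rw [hφ ⟨x, hx⟩, hφ ⟨y, hy⟩]
    exact strictMono_of_embedding f hxy) (fun e he => by
    rw [hφ ⟨e, hES he⟩]
    exact hf ⟨e, hES he⟩ he)
  exact ⟨equivOfOrderIso g, fun x => (hg x x.2).trans (hφ x)⟩

theorem isWeaklyUltrahomogeneous_iff [Countable α] :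
    IsWeaklyUltrahomogeneous Language.order α ↔
      ∃ E : Set α, E.Finite ∧ LocallyDenseOff (· < ·) E := by
  constructor
  · rintro ⟨E, hE, h⟩
    refine ⟨E ∪ isolatedPoints E, ?_, OrderHomogeneousOver.locallyDenseOff hE ?_⟩
    · rw [← Set.union_sdiff_self]
      exact hE.union (finite_isolatedPoints_diff hE)
    · intro S φ hS hES hφ hfix
      obtain ⟨g, hg⟩ := h _ _ (Substructure.fg_closure hS) (Substructure.fg_closure (hS.image φ))
        (hES.trans Substructure.subset_closure)
        (fun e he => Substructure.subset_closure ⟨e, hES he, hfix e he⟩)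
        (equivOfStrictMonoOn S φ hφ) (fun x hx => hfix x hx)
      exact ⟨orderIsoOfEquiv g, fun x hx => hg ⟨x, Substructure.subset_closure hx⟩⟩
  · rintro ⟨E, hE, h⟩
    refine ⟨E, hE, fun S T hS _ hES _ f hf => ?_⟩
    exact h.orderHomogeneousOver.exists_equiv hS hES (T.subtype.comp f.toEmbedding) hf

theorem isUltrahomogeneous_iff [Countable α] [Nontrivial α] :
    Language.IsUltrahomogeneous Language.order α ↔ LocallyDenseOff (· < ·) (∅ : Set α) := by
  constructor
  · intro h
    -- Without parameters there is a single component, and it has two points.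
    have hiso : ∅ ∪ isolatedPoints (∅ : Set α) = ∅ := by
      rw [Set.empty_union, Set.eq_empty_iff_forall_notMem]
      intro m hm
      obtain ⟨u, hu⟩ := exists_ne m
      exact hu (hm u ⟨by simp, by simp, by simp⟩)
    rw [← hiso]
    refine OrderHomogeneousOver.locallyDenseOff Set.finite_empty ?_
    intro S φ hS _ hφ _
    obtain ⟨g, hg⟩ := h _ (Substructure.fg_closure hS)
      ((Substructure.subtype _).comp (equivOfStrictMonoOn S φ hφ).toEmbedding)
    refine ⟨orderIsoOfEquiv g, fun x hx => ?_⟩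
    exact (DFunLike.congr_fun hg ⟨x, Substructure.subset_closure hx⟩).symm
  · intro h S hS f
    obtain ⟨g, hg⟩ := h.orderHomogeneousOver.exists_equiv hS (Set.empty_subset _) f
      (fun x hx => hx.elim)
    exact ⟨g, DFunLike.ext _ _ fun x => (hg x).symm⟩

end Structure

/-! ### Upper bounds for the index sets -/

section IndexSets

open Nat.Partrec (Code)
open Nat.Partrec.Code Denumerable

/-- The `e`-th program, run on `(a, b)` for `s` steps, has halted with value `t`. -/
def HaltsWith (t s e a b : ℕ) : Prop :=
  evaln s (ofNat Code e) (Nat.pair a b) = some t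

/-- The triple `x` is no counterexample to the `e`-th program computing a linear order that is
locally dense off the list `E`, as witnessed by `y`. -/
def DenseOrderWitness (e : ℕ) (E : List ℕ) (x : ℕ × ℕ × ℕ) (y : ℕ × ℕ × ℕ × ℕ × ℕ) : Prop :=
  let lt := fun a b => HaltsWith 1 y.1 e a b
  let nlt := fun a b => HaltsWith 0 y.1 e a b
  (lt x.1 x.2.1 ∨ nlt x.1 x.2.1) ∧ nlt x.1 x.1 ∧
    (nlt x.1 x.2.1 ∨ nlt x.2.1 x.2.2 ∨ lt x.1 x.2.2) ∧
    (x.1 = x.2.1 ∨ lt x.1 x.2.1 ∨ lt x.2.1 x.1) ∧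
    ((∃ z ∈ E, z = x.1) ∨
      lt y.2.1 x.1 ∧ lt x.1 y.2.2.1 ∧
        (nlt x.2.1 x.1 ∨ lt x.2.1 y.2.2.2.1 ∧ lt y.2.2.2.1 x.1) ∧
        (nlt x.1 x.2.1 ∨ lt x.1 y.2.2.2.2 ∧ lt y.2.2.2.2 x.2.1))

lemma primrecPred_haltsWith {α : Type*} [Primcodable α] (t : ℕ) {s e a b : α → ℕ}
    (hs : Primrec s) (he : Primrec e) (ha : Primrec a) (hb : Primrec b) :
    PrimrecPred fun x => HaltsWith t (s x) (e x) (a x) (b x) :=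
  Primrec.eq.comp (primrec_evaln.comp ((hs.pair ((Primrec.ofNat Code).comp he)).pair
    (Primrec₂.natPair.comp ha hb))) (Primrec.const (some t))

lemma primrecPred_denseOrderWitness :
    PrimrecPred fun p : (ℕ × List ℕ) × (ℕ × ℕ × ℕ) × (ℕ × ℕ × ℕ × ℕ × ℕ) =>
      DenseOrderWitness p.1.1 p.1.2 p.2.1 p.2.2 := by
  have he : Primrec fun p : (ℕ × List ℕ) × (ℕ × ℕ × ℕ) × (ℕ × ℕ × ℕ × ℕ × ℕ) => p.1.1 :=
    Primrec.fst.comp Primrec.fst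
  have hE : Primrec fun p : (ℕ × List ℕ) × (ℕ × ℕ × ℕ) × (ℕ × ℕ × ℕ × ℕ × ℕ) => p.1.2 :=
    Primrec.snd.comp Primrec.fst
  have hx : Primrec fun p : (ℕ × List ℕ) × (ℕ × ℕ × ℕ) × (ℕ × ℕ × ℕ × ℕ × ℕ) => p.2.1 :=
    Primrec.fst.comp Primrec.snd
  have hy : Primrec fun p : (ℕ × List ℕ) × (ℕ × ℕ × ℕ) × (ℕ × ℕ × ℕ × ℕ × ℕ) => p.2.2 :=
    Primrec.snd.comp Primrec.snd
  have h1 := Primrec.fst.comp hx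
  have h2 := Primrec.fst.comp (Primrec.snd.comp hx)
  have h3 := Primrec.snd.comp (Primrec.snd.comp hx)
  have k1 := Primrec.fst.comp hy
  have k2 := Primrec.fst.comp (Primrec.snd.comp hy)
  have k3 := Primrec.fst.comp (Primrec.snd.comp (Primrec.snd.comp hy))
  have k4 := Primrec.fst.comp (Primrec.snd.comp (Primrec.snd.comp (Primrec.snd.comp hy)))
  have k5 := Primrec.snd.comp (Primrec.snd.comp (Primrec.snd.comp (Primrec.snd.comp hy)))
  have H := fun t {a b} => @primrecPred_haltsWith _ _ t _ _ a b k1 he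
  exact ((H 1 h1 h2).or (H 0 h1 h2)).and <| (H 0 h1 h1).and <|
    ((H 0 h1 h2).or ((H 0 h2 h3).or (H 1 h1 h3))).and <|
    ((Primrec.eq.comp h1 h2).or ((H 1 h1 h2).or (H 1 h2 h1))).and <|
    ((Primrec.eq.exists_mem_list).comp hE h1).or <|
    (H 1 k2 h1).and <| (H 1 h1 k3).and <|
    ((H 0 h2 h1).or ((H 1 h2 k4).and (H 1 k4 h1))).and
    ((H 0 h1 h2).or ((H 1 h1 k5).and (H 1 k5 h2)))

lemma HaltsWith.phi_eq {t s e a b : ℕ} (h : HaltsWith t s e a b) :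
    phi e (Nat.pair a b) = Part.some t :=
  Part.eq_some_iff.2 (evaln_sound h)

/-- More steps never change a computed value, so one bound serves finitely many comparisons. -/
lemma IsIndexOf.exists_bound {e : ℕ} {lo : LinearOrder ℕ} (h : IsIndexOf e lo)
    (F : Finset (ℕ × ℕ)) :
    ∃ s, ∀ p ∈ F, (lo.lt p.1 p.2 → HaltsWith 1 s e p.1 p.2) ∧
      (¬ lo.lt p.1 p.2 → HaltsWith 0 s e p.1 p.2) := by
  classical
  induction F using Finset.induction_on with
  | empty => exact ⟨0, by simp⟩
  | insert p F _ ih =>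
    obtain ⟨s, hs⟩ := ih
    obtain ⟨s', hs'⟩ := evaln_complete.1 (Part.eq_some_iff.1 (h p.1 p.2))
    refine ⟨s + s', fun q hq => ?_⟩
    rcases Finset.mem_insert.1 hq with rfl | hq
    · have := evaln_mono (Nat.le_add_left s' s) hs'
      constructor <;> intro hlt <;> simpa [HaltsWith, hlt] using this
    · exact ⟨fun hlt => evaln_mono (Nat.le_add_right s s') ((hs q hq).1 hlt),
        fun hlt => evaln_mono (Nat.le_add_right s s') ((hs q hq).2 hlt)⟩

/-- The negative facts in a witness are computed values `0`, hence truly refute `r`. Each clause,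
read over all `x`, thus becomes an order axiom or local density. -/
lemma exists_linearOrder_of_witness {e : ℕ} {E : List ℕ}
    (h : ∀ x, ∃ y, DenseOrderWitness e E x y) :
    ∃ lo : LinearOrder ℕ, IsIndexOf e lo ∧ LocallyDenseOff lo.lt {m | m ∈ E} := by
  classical
  let r : ℕ → ℕ → Prop := fun a b => phi e (Nat.pair a b) = Part.some 1
  have hr : ∀ {s a b}, HaltsWith 1 s e a b → r a b := fun h => h.phi_eq
  have hnr : ∀ {s a b}, HaltsWith 0 s e a b → ¬ r a b := fun h h' => by
    have := h.phi_eq.symm.trans h'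
    simp at this
  have irr : ∀ a, ¬ r a a := fun a => by
    obtain ⟨y, -, h, -⟩ := h (a, a, a)
    exact hnr h
  have trans : ∀ a b c, r a b → r b c → r a c := fun a b c hab hbc => by
    obtain ⟨y, -, -, h, -⟩ := h (a, b, c)
    rcases h with h | h | h
    exacts [(hnr h hab).elim, (hnr h hbc).elim, hr h]
  have tri : ∀ a b, a = b ∨ r a b ∨ r b a := fun a b => by
    obtain ⟨y, -, -, -, h, -⟩ := h (a, b, 0)
    rcases h with h | h | h
    exacts [Or.inl h, Or.inr (Or.inl (hr h)), Or.inr (Or.inr (hr h))]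
  have : IsStrictTotalOrder ℕ r :=
    { irrefl := irr
      trans := trans
      trichotomous := fun a b hab hba => (tri a b).resolve_right (not_or.2 ⟨hab, hba⟩) }
  let lo : LinearOrder ℕ := linearOrderOfSTO r
  refine ⟨lo, fun a b => ?_, fun m hm => ?_⟩
  · obtain ⟨y, h, -⟩ := h (a, b, 0)
    rcases h with h | h
    · exact h.phi_eq.trans (congrArg Part.some (if_pos (hr h)).symm)
    · exact h.phi_eq.trans (congrArg Part.some (if_neg (hnr h)).symm)
  · have key : ∀ u, ∃ y : ℕ × ℕ × ℕ × ℕ × ℕ, r y.2.1 m ∧ r m y.2.2.1 ∧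
        (r u m → r u y.2.2.2.1 ∧ r y.2.2.2.1 m) ∧ (r m u → r m y.2.2.2.2 ∧ r y.2.2.2.2 u) := by
      intro u
      obtain ⟨y, -, -, -, -, h⟩ := h (m, u, 0)
      rcases h with ⟨z, hz, rfl⟩ | ⟨h1, h2, h3, h4⟩
      · exact (hm hz).elim
      · exact ⟨y, hr h1, hr h2, fun hu => h3.elim (fun h => (hnr h hu).elim)
          fun h => ⟨hr h.1, hr h.2⟩, fun hu => h4.elim (fun h => (hnr h hu).elim)
          fun h => ⟨hr h.1, hr h.2⟩⟩
    obtain ⟨y, h1, h2, -⟩ := key m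
    refine ⟨⟨_, h1⟩, ⟨_, h2⟩, fun u hu => ?_, fun u hu => ?_⟩
    · obtain ⟨y, -, -, h3, -⟩ := key u
      exact ⟨_, h3 hu⟩
    · obtain ⟨y, -, -, -, h4⟩ := key u
      exact ⟨_, h4 hu⟩

lemma exists_witness_of_linearOrder {e : ℕ} {E : List ℕ} {lo : LinearOrder ℕ}
    (hlo : IsIndexOf e lo) (h : LocallyDenseOff lo.lt {m | m ∈ E}) (x : ℕ × ℕ × ℕ) :
    ∃ y, DenseOrderWitness e E x y := by
  obtain ⟨m, u, w⟩ := x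
  have irr : ∀ a, ¬ lo.lt a a := fun a => @lt_irrefl _ lo.toPreorder a
  have trans : ∀ {a b c}, lo.lt a b → lo.lt b c → lo.lt a c :=
    fun {a b c} => @lt_trans _ lo.toPreorder a b c
  have tri : ∀ a b, lo.lt a b ∨ a = b ∨ lo.lt b a := @lt_trichotomy _ lo
  obtain ⟨d1, d2, c1, c2, hd⟩ : ∃ d1 d2 c1 c2, m ∉ E → lo.lt d1 m ∧ lo.lt m d2 ∧
      (lo.lt u m → lo.lt u c1 ∧ lo.lt c1 m) ∧ (lo.lt m u → lo.lt m c2 ∧ lo.lt c2 u) := by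
    by_cases hm : m ∈ E
    · exact ⟨0, 0, 0, 0, fun h => (h hm).elim⟩
    obtain ⟨⟨d1, h1⟩, ⟨d2, h2⟩, h3, h4⟩ := h m hm
    obtain ⟨c1, hc1⟩ : ∃ c, lo.lt u m → lo.lt u c ∧ lo.lt c m := by
      by_cases hu : lo.lt u m
      · exact (h3 u hu).imp fun c hc _ => hc
      · exact ⟨0, fun h => (hu h).elim⟩
    obtain ⟨c2, hc2⟩ : ∃ c, lo.lt m u → lo.lt m c ∧ lo.lt c u := by
      by_cases hu : lo.lt m u
      · exact (h4 u hu).imp fun c hc _ => hc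
      · exact ⟨0, fun h => (hu h).elim⟩
    exact ⟨d1, d2, c1, c2, fun _ => ⟨h1, h2, hc1, hc2⟩⟩
  -- All numbers that the clauses compare; a common step bound for their pairs becomes `y.1`.
  let F : Finset ℕ := {m, u, w, d1, d2, c1, c2}
  obtain ⟨s, hs⟩ := hlo.exists_bound (F ×ˢ F)
  have hs1 : ∀ a ∈ F, ∀ b ∈ F, lo.lt a b → HaltsWith 1 s e a b := fun a ha b hb =>
    (hs (a, b) (Finset.mem_product.2 ⟨ha, hb⟩)).1
  have hs0 : ∀ a ∈ F, ∀ b ∈ F, ¬ lo.lt a b → HaltsWith 0 s e a b := fun a ha b hb =>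
    (hs (a, b) (Finset.mem_product.2 ⟨ha, hb⟩)).2
  have m1 : m ∈ F := by simp [F]
  have m2 : u ∈ F := by simp [F]
  have m3 : w ∈ F := by simp [F]
  have m4 : d1 ∈ F := by simp [F]
  have m5 : d2 ∈ F := by simp [F]
  have m6 : c1 ∈ F := by simp [F]
  have m7 : c2 ∈ F := by simp [F]
  refine ⟨(s, d1, d2, c1, c2), ?_, hs0 m m1 m m1 (irr m), ?_, ?_, ?_⟩
  · exact (em (lo.lt m u)).imp (hs1 m m1 u m2) (hs0 m m1 u m2)
  · by_cases h1 : lo.lt m u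
    · by_cases h2 : lo.lt u w
      · exact Or.inr (Or.inr (hs1 m m1 w m3 (trans h1 h2)))
      · exact Or.inr (Or.inl (hs0 u m2 w m3 h2))
    · exact Or.inl (hs0 m m1 u m2 h1)
  · rcases tri m u with h | h | h
    exacts [Or.inr (Or.inl (hs1 m m1 u m2 h)), Or.inl h, Or.inr (Or.inr (hs1 u m2 m m1 h))]
  · by_cases hm : m ∈ E
    · exact Or.inl ⟨m, hm, rfl⟩
    · obtain ⟨h1, h2, h3, h4⟩ := hd hm
      refine Or.inr ⟨hs1 d1 m4 m m1 h1, hs1 m m1 d2 m5 h2, ?_, ?_⟩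
      · by_cases hu : lo.lt u m
        · exact Or.inr ⟨hs1 u m2 c1 m6 (h3 hu).1, hs1 c1 m6 m m1 (h3 hu).2⟩
        · exact Or.inl (hs0 u m2 m m1 hu)
      · by_cases hu : lo.lt m u
        · exact Or.inr ⟨hs1 m m1 c2 m7 (h4 hu).1, hs1 c2 m7 u m2 (h4 hu).2⟩
        · exact Or.inl (hs0 m m1 u m2 hu)

theorem forall_exists_denseOrderWitness_iff {e : ℕ} {E : List ℕ} :
    (∀ x, ∃ y, DenseOrderWitness e E x y) ↔
      ∃ lo : LinearOrder ℕ, IsIndexOf e lo ∧ LocallyDenseOff lo.lt {m | m ∈ E} :=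
  ⟨exists_linearOrder_of_witness, fun ⟨_, h, h'⟩ => exists_witness_of_linearOrder h h'⟩

lemma orderedStructure_orderStr (lo : LinearOrder ℕ) :
    @Language.OrderedStructure Language.order ℕ _ lo.toLE (orderStr lo) :=
  @Language.OrderedStructure.mk Language.order ℕ _ lo.toLE (orderStr lo) fun _ => Iff.rfl

theorem mem_UHL_iff {e : ℕ} : e ∈ UHL ↔
    ∃ lo : LinearOrder ℕ, IsIndexOf e lo ∧ LocallyDenseOff lo.lt ∅ :=
  exists_congr fun lo => and_congr_right fun _ =>
    @isUltrahomogeneous_iff ℕ lo (orderStr lo) (orderedStructure_orderStr lo) _ _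

theorem mem_WUL_iff {e : ℕ} : e ∈ WUL ↔
    ∃ lo : LinearOrder ℕ, IsIndexOf e lo ∧ ∃ E : Set ℕ, E.Finite ∧ LocallyDenseOff lo.lt E :=
  exists_congr fun lo => and_congr_right fun _ =>
    @isWeaklyUltrahomogeneous_iff ℕ lo (orderStr lo) (orderedStructure_orderStr lo) _

/-- The list of numbers coded by a number. -/
def listOfNat (n : ℕ) : List ℕ := (Encodable.decode n).getD []

lemma listOfNat_surjective : Function.Surjective listOfNat := fun l =>
  ⟨Encodable.encode l, by simp [listOfNat]⟩

lemma primrec_listOfNat : Primrec listOfNat :=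
  Primrec.option_getD.comp Primrec.decode (Primrec.const [])

/-- Packs the tuples of `DenseOrderWitness` into single numbers, as the quantifiers in `IsPi02` and
`IsSigma03` require. -/
theorem exists_primrecPred_locallyDense : ∃ Q : ℕ × ℕ × ℕ × ℕ → Prop, PrimrecPred Q ∧
    ∀ e E, (∀ x, ∃ y, Q (e, E, x, y)) ↔
      ∃ lo : LinearOrder ℕ, IsIndexOf e lo ∧ LocallyDenseOff lo.lt {m | m ∈ listOfNat E} := by
  let d3 : ℕ → ℕ × ℕ × ℕ := fun n => (n.unpair.1, n.unpair.2.unpair)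
  let d5 : ℕ → ℕ × ℕ × ℕ × ℕ × ℕ := fun n =>
    (n.unpair.1, n.unpair.2.unpair.1, d3 n.unpair.2.unpair.2)
  have h3 : Primrec d3 := (Primrec.fst.comp Primrec.unpair).pair
    (Primrec.unpair.comp (Primrec.snd.comp Primrec.unpair))
  have h5 : Primrec d5 := (Primrec.fst.comp Primrec.unpair).pair
    ((Primrec.fst.comp (Primrec.unpair.comp (Primrec.snd.comp Primrec.unpair))).pair
      (h3.comp (Primrec.snd.comp (Primrec.unpair.comp (Primrec.snd.comp Primrec.unpair)))))
  have s3 : Function.Surjective d3 := fun ⟨a, b, c⟩ => ⟨Nat.pair a (Nat.pair b c), by simp [d3]⟩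
  have s5 : Function.Surjective d5 := fun ⟨a, b, x⟩ => by
    obtain ⟨n, rfl⟩ := s3 x
    exact ⟨Nat.pair a (Nat.pair b n), by simp [d5]⟩
  refine ⟨fun p => DenseOrderWitness p.1 (listOfNat p.2.1) (d3 p.2.2.1) (d5 p.2.2.2), ?_,
    fun e E => ?_⟩
  · have h := Primrec.snd (α := ℕ) (β := ℕ × ℕ × ℕ)
    have h' : Primrec fun p : ℕ × ℕ × ℕ × ℕ =>
        ((p.1, listOfNat p.2.1), (d3 p.2.2.1, d5 p.2.2.2)) :=
      (Primrec.fst.pair (primrec_listOfNat.comp (Primrec.fst.comp h))).pair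
        ((h3.comp (Primrec.fst.comp (Primrec.snd.comp h))).pair
          (h5.comp (Primrec.snd.comp (Primrec.snd.comp h))))
    exact primrecPred_denseOrderWitness.comp h'
  · rw [← forall_exists_denseOrderWitness_iff, s3.forall]
    exact forall_congr' fun x =>
      (s5.exists (p := DenseOrderWitness e (listOfNat E) (d3 x))).symm

theorem isPi02_UHL : IsPi02 UHL := by
  obtain ⟨Q, hQ, h⟩ := exists_primrecPred_locallyDense
  obtain ⟨E, hE⟩ := listOfNat_surjective []
  refine ⟨fun p => Q (p.1, E, p.2), PrimrecPred.computablePred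
    (hQ.comp (Primrec.fst.pair ((Primrec.const E).pair Primrec.snd))), fun n => ?_⟩
  have : (∅ : Set ℕ) = {m | m ∈ listOfNat E} := by simp [hE]
  rw [mem_UHL_iff, h, this]

theorem isSigma03_WUL : IsSigma03 WUL := by
  obtain ⟨Q, hQ, h⟩ := exists_primrecPred_locallyDense
  refine ⟨Q, hQ.computablePred, fun n => ?_⟩
  rw [mem_WUL_iff, exists_congr fun E => h n E]
  constructor
  · rintro ⟨lo, hlo, E, hE, h⟩
    obtain ⟨l, hl⟩ := listOfNat_surjective hE.toFinset.toList
    refine ⟨l, lo, hlo, ?_⟩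
    have : {m | m ∈ listOfNat l} = E := by ext; simp [hl]
    rwa [this]
  · rintro ⟨E, lo, hlo, h⟩
    exact ⟨lo, hlo, _, List.finite_toSet _, h⟩

end IndexSets

/-! ### The order built from an activation: blocks, sections and places -/

section Construction

/-- Lexicographic comparison of triples. -/
def lexLt (a b : ℕ × ℕ × ℚ) : Prop :=
  a.1 < b.1 ∨ a.1 = b.1 ∧ (a.2.1 < b.2.1 ∨ a.2.1 = b.2.1 ∧ a.2.2 < b.2.2)

lemma toLex_lt_iff_lexLt {a b : ℕ × ℕ × ℚ} :
    toLex (a.1, toLex a.2) < toLex (b.1, toLex b.2) ↔ lexLt a b := by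
  rw [Prod.Lex.toLex_lt_toLex, Prod.Lex.toLex_lt_toLex]
  rfl

/-- The linear order on `ℕ` pulled back from the lexicographic order. -/
noncomputable abbrev pullbackOrder (f : ℕ → ℕ × ℕ × ℚ) (hf : Function.Injective f) :
    LinearOrder ℕ :=
  LinearOrder.lift' (β := ℕ ×ₗ (ℕ ×ₗ ℚ)) (fun m => toLex ((f m).1, toLex (f m).2))
    fun _ _ h => hf h

lemma pullbackOrder_lt {f : ℕ → ℕ × ℕ × ℚ} {hf : Function.Injective f} {a b : ℕ} :
    (pullbackOrder f hf).lt a b ↔ lexLt (f a) (f b) :=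
  toLex_lt_iff_lexLt

/-- The triple denoted by a quadruple of numbers; the last two are numerator and binary exponent
of a dyadic rational. -/
def dyadicTriple (a : ℕ × ℕ × ℕ × ℕ) : ℕ × ℕ × ℚ := (a.1, a.2.1, a.2.2.1 / 2 ^ a.2.2.2)

/-- Clearing denominators leaves a comparison of natural numbers, which is visibly decidable. -/
lemma lexLt_dyadicTriple {a b : ℕ × ℕ × ℕ × ℕ} : lexLt (dyadicTriple a) (dyadicTriple b) ↔
    a.1 < b.1 ∨ a.1 = b.1 ∧ (a.2.1 < b.2.1 ∨ a.2.1 = b.2.1 ∧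
      a.2.2.1 * 2 ^ b.2.2.2 < b.2.2.1 * 2 ^ a.2.2.2) := by
  simp only [lexLt, dyadicTriple]
  rw [div_lt_div_iff₀ (by positivity) (by positivity)]
  norm_cast

lemma dyadic_injective {r l r' l' : ℕ}
    (h : ((2 * r + 1 : ℕ) : ℚ) / 2 ^ l = (2 * r' + 1 : ℕ) / 2 ^ l') : r = r' ∧ l = l' := by
  rw [div_eq_div_iff (by positivity) (by positivity)] at h
  have h : (2 * r + 1) * 2 ^ l' = (2 * r' + 1) * 2 ^ l := by exact_mod_cast h
  have hl : l = l' := by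
    rcases lt_trichotomy l l' with hl | hl | hl
    · obtain ⟨d, rfl⟩ := Nat.exists_eq_add_of_lt hl
      rw [add_assoc, pow_add, ← mul_assoc, mul_right_comm] at h
      have := Nat.eq_of_mul_eq_mul_right (by positivity) h
      have h2 : (2 * r + 1) * 2 ^ (d + 1) = 2 * ((2 * r + 1) * 2 ^ d) := by ring
      omega
    · exact hl
    · obtain ⟨d, rfl⟩ := Nat.exists_eq_add_of_lt hl
      rw [add_assoc, pow_add, ← mul_assoc, mul_right_comm (2 * r' + 1)] at h
      have := Nat.eq_of_mul_eq_mul_right (by positivity) h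
      have h2 : (2 * r' + 1) * 2 ^ (d + 1) = 2 * ((2 * r' + 1) * 2 ^ d) := by ring
      omega
  subst hl
  have := Nat.eq_of_mul_eq_mul_right (by positivity) h
  exact ⟨by omega, rfl⟩

lemma dyadic_ne_even {r l s : ℕ} :
    ((2 * r + 1 : ℕ) : ℚ) / 2 ^ l ≠ (2 * s + 2 : ℕ) / 2 ^ 0 := by
  intro h
  rw [div_eq_div_iff (by positivity) (by positivity)] at h
  have h : (2 * r + 1) * 2 ^ 0 = (2 * s + 2) * 2 ^ l := by exact_mod_cast h
  have : (2 * s + 2) * 2 ^ l = 2 * ((s + 1) * 2 ^ l) := by ring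
  omega

lemma exists_dyadic_between {q q' : ℚ} (hq : 0 ≤ q) (h : q < q') :
    ∃ r l : ℕ, q < ((2 * r + 1 : ℕ) : ℚ) / 2 ^ l ∧ ((2 * r + 1 : ℕ) : ℚ) / 2 ^ l < q' := by
  obtain ⟨l, hl⟩ := pow_unbounded_of_one_lt (2 / (q' - q)) (one_lt_two (α := ℚ))
  -- Scaled by `2 ^ l` the gap exceeds 2, so both integers following the floor `t` lie in it, and
  -- one of them is odd.
  have hl : 2 < (q' - q) * 2 ^ l := by
    rwa [div_lt_iff₀ (by linarith), mul_comm] at hl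
  have h1 := Nat.lt_floor_add_one (q * 2 ^ l)
  have h2 := Nat.floor_le (show 0 ≤ q * 2 ^ l by positivity)
  generalize ⌊q * 2 ^ l⌋₊ = t at h1 h2
  have key : ∀ r : ℕ, t < 2 * r + 1 → 2 * r + 1 ≤ t + 2 →
      q < ((2 * r + 1 : ℕ) : ℚ) / 2 ^ l ∧ ((2 * r + 1 : ℕ) : ℚ) / 2 ^ l < q' := by
    intro r hr hr'
    rw [lt_div_iff₀ (by positivity), div_lt_iff₀ (by positivity)]
    have hr : (t : ℚ) + 1 ≤ (2 * r + 1 : ℕ) := by exact_mod_cast hr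
    have hr' : ((2 * r + 1 : ℕ) : ℚ) ≤ t + 2 := by exact_mod_cast hr'
    constructor <;> nlinarith
  obtain ⟨u, hu | hu⟩ := Nat.even_or_odd' t
  · exact ⟨u, l, key u (by omega) (by omega)⟩
  · exact ⟨u + 1, l, key (u + 1) (by omega) (by omega)⟩

/-- Activation of the sections `i` of the blocks `x` at stages `k`. -/
structure IsActivation (act : ℕ → ℕ → ℕ → Bool) : Prop where
  zero : ∀ x k, act x 0 k = true
  one : ∀ x k, act x 1 k = true
  mono : ∀ {x i k k'}, k ≤ k' → act x i k = true → act x i k' = true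
  anti : ∀ {x i i' k}, i' ≤ i → act x i k = true → act x i' k = true

/-- The place of the point `k` of section `i` of block `x`, where `b` says whether the section is
active at stage `k`, and `c` counts the previous stages at which it was. -/
def place (b : Bool) (c x i k : ℕ) : ℕ × ℕ × ℕ × ℕ :=
  bif b then
    -- The first active stage supplies the top of the section, or the end of the block when `i = 0`;
    -- later ones run through all dyadics with odd numerator.
    Nat.casesOn c (bif decide (i = 0) then (2 * x + 1, 0, 0, 0) else (2 * x, 2 * i + 1, 0, 0))
      fun j => (2 * x, 2 * i, 2 * j.unpair.1 + 1, j.unpair.2)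
  -- Points of inactive stages are parked in section 0 at even integers, which the odd numerators
  -- never hit. So every number gets a place, without creating gaps.
  else (2 * x, 0, 2 * Nat.pair i k + 2, 0)

variable (act : ℕ → ℕ → ℕ → Bool)

/-- The place of the point `m` in the order built from `act`. -/
def placeOf (m : ℕ) : ℕ × ℕ × ℕ × ℕ :=
  place (act m.unpair.1 m.unpair.2.unpair.1 m.unpair.2.unpair.2)
    (Nat.count (fun k => act m.unpair.1 m.unpair.2.unpair.1 k = true) m.unpair.2.unpair.2)
    m.unpair.1 m.unpair.2.unpair.1 m.unpair.2.unpair.2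

/-- Section `i` of block `x` becomes active at some stage. -/
def IsActive (x i : ℕ) : Prop := ∃ k, act x i k = true

variable {act}

lemma placeOf_pair (x i k : ℕ) : placeOf act (Nat.pair x (Nat.pair i k)) =
    place (act x i k) (Nat.count (fun k => act x i k = true) k) x i k := by
  simp [placeOf]

lemma exists_pair (m : ℕ) : ∃ x i k, m = Nat.pair x (Nat.pair i k) :=
  ⟨m.unpair.1, m.unpair.2.unpair.1, m.unpair.2.unpair.2, by simp⟩

lemma placeOf_cases (m : ℕ) : ∃ x i k, m = Nat.pair x (Nat.pair i k) ∧
    ((act x i k = false ∧ placeOf act m = (2 * x, 0, 2 * Nat.pair i k + 2, 0)) ∨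
      (act x i k = true ∧ ∃ r l, Nat.count (fun k => act x i k = true) k = Nat.pair r l + 1 ∧
        placeOf act m = (2 * x, 2 * i, 2 * r + 1, l)) ∨
      (act x i k = true ∧ Nat.count (fun k => act x i k = true) k = 0 ∧ i = 0 ∧
        placeOf act m = (2 * x + 1, 0, 0, 0)) ∨
      (act x i k = true ∧ Nat.count (fun k => act x i k = true) k = 0 ∧ i ≠ 0 ∧
        placeOf act m = (2 * x, 2 * i + 1, 0, 0))) := by
  obtain ⟨x, i, k, rfl⟩ := exists_pair m
  refine ⟨x, i, k, rfl, ?_⟩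
  rw [placeOf_pair]
  cases hb : act x i k
  · simp [place]
  · rcases hc : Nat.count (fun k => act x i k = true) k with _ | j
    · by_cases hi : i = 0 <;> simp [place, hi]
    · refine Or.inr (Or.inl ⟨rfl, j.unpair.1, j.unpair.2, by simp, by simp [place]⟩)

/-- Parities of the first two coordinates separate most kinds of places. Within one kind, the
section and the count of active stages recover the stage. -/
lemma injective_dyadicTriple_placeOf :
    Function.Injective fun m => dyadicTriple (placeOf act m) := by
  intro m m' h
  obtain ⟨x, i, k, rfl, hm⟩ := placeOf_cases (act := act) m
  obtain ⟨x', i', k', rfl, hm'⟩ := placeOf_cases (act := act) m'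
  simp only [dyadicTriple, Prod.mk.injEq] at h
  obtain ⟨hX, hI, hq⟩ := h
  rcases hm with ⟨ha, hp⟩ | ⟨ha, r, l, hc, hp⟩ | ⟨ha, hc, hi, hp⟩ | ⟨ha, hc, hi, hp⟩ <;>
  rcases hm' with ⟨ha', hp'⟩ | ⟨ha', r', l', hc', hp'⟩ | ⟨ha', hc', hi', hp'⟩ |
    ⟨ha', hc', hi', hp'⟩ <;>
  rw [hp, hp'] at hX hI hq <;> dsimp only at hX hI hq <;> try omega
  · simp only [pow_zero, div_one, Nat.cast_inj, add_left_inj, mul_eq_mul_left_iff,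
      OfNat.ofNat_ne_zero, or_false] at hq
    rw [hq, show x = x' by omega]
  · exact (dyadic_ne_even hq.symm).elim
  · exact (dyadic_ne_even hq).elim
  · obtain rfl : x = x' := by omega
    obtain rfl : i = i' := by omega
    obtain ⟨rfl, rfl⟩ := dyadic_injective hq
    rw [Nat.count_injective ha ha' (hc.trans hc'.symm)]
  · obtain rfl : x = x' := by omega
    subst hi hi'
    rw [Nat.count_injective ha ha' (hc.trans hc'.symm)]
  · obtain rfl : x = x' := by omega
    obtain rfl : i = i' := by omega
    rw [Nat.count_injective ha ha' (hc.trans hc'.symm)]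

/-- Activity persists, so an active section has infinitely many active stages and the count takes
every value. -/
lemma IsActivation.exists_count (h : IsActivation act) {x i : ℕ} (hi : IsActive act x i) (c : ℕ) :
    ∃ k, act x i k = true ∧ Nat.count (fun k => act x i k = true) k = c := by
  obtain ⟨k, hk⟩ := hi
  have hinf : {k | act x i k = true}.Infinite :=
    Set.infinite_of_forall_exists_gt fun n =>
      ⟨k + n + 1, h.mono (by omega) hk, by omega⟩
  exact ⟨_, Nat.nth_mem_of_infinite hinf c, Nat.count_nth_of_infinite hinf c⟩

lemma IsActivation.exists_placeOf_dense (h : IsActivation act) {x i : ℕ} (hi : IsActive act x i)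
    (r l : ℕ) : ∃ m, placeOf act m = (2 * x, 2 * i, 2 * r + 1, l) := by
  obtain ⟨k, hk, hc⟩ := h.exists_count hi (Nat.pair r l + 1)
  exact ⟨Nat.pair x (Nat.pair i k), by rw [placeOf_pair, hk, hc]; simp [place]⟩

lemma IsActivation.exists_placeOf_top (h : IsActivation act) {x i : ℕ} (hi : IsActive act x i)
    (hi0 : i ≠ 0) : ∃ m, placeOf act m = (2 * x, 2 * i + 1, 0, 0) := by
  obtain ⟨k, hk, hc⟩ := h.exists_count hi 0
  exact ⟨Nat.pair x (Nat.pair i k), by rw [placeOf_pair, hk, hc]; simp [place, hi0]⟩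

lemma IsActivation.exists_placeOf_end (h : IsActivation act) (x : ℕ) :
    ∃ m, placeOf act m = (2 * x + 1, 0, 0, 0) := by
  obtain ⟨k, hk, hc⟩ := h.exists_count ⟨0, h.zero x 0⟩ 0
  exact ⟨Nat.pair x (Nat.pair 0 k), by rw [placeOf_pair, hk, hc]; simp [place]⟩

/-- The triples occurring in the order built from `act`. -/
lemma IsActivation.triple_cases (h : IsActivation act) (m : ℕ) :
    (∃ x i, IsActive act x i ∧ ∃ q : ℚ, 0 < q ∧ dyadicTriple (placeOf act m) = (2 * x, 2 * i, q)) ∨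
    (∃ x i, IsActive act x i ∧ i ≠ 0 ∧ placeOf act m = (2 * x, 2 * i + 1, 0, 0)) ∨
    (∃ x, placeOf act m = (2 * x + 1, 0, 0, 0)) := by
  obtain ⟨x, i, k, rfl, hm⟩ := placeOf_cases (act := act) m
  rcases hm with ⟨-, hp⟩ | ⟨ha, r, l, -, hp⟩ | ⟨-, -, -, hp⟩ | ⟨ha, -, hi, hp⟩
  · exact Or.inl ⟨x, 0, ⟨0, h.zero x 0⟩, ((2 * Nat.pair i k + 2 : ℕ) : ℚ) / 2 ^ 0, by positivity,
      by rw [hp]; rfl⟩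
  · exact Or.inl ⟨x, i, ⟨k, ha⟩, ((2 * r + 1 : ℕ) : ℚ) / 2 ^ l, by positivity, by rw [hp]; rfl⟩
  · exact Or.inr (Or.inr ⟨x, hp⟩)
  · exact Or.inr (Or.inl ⟨x, i, ⟨k, ha⟩, hi, hp⟩)

lemma IsActivation.exists_between (h : IsActivation act) {x i : ℕ} (hi : IsActive act x i)
    {q q' : ℚ} (hq : 0 ≤ q) (hqq : q < q') : ∃ m t, q < t ∧ t < q' ∧
      dyadicTriple (placeOf act m) = (2 * x, 2 * i, t) := by
  obtain ⟨r, l, h1, h2⟩ := exists_dyadic_between hq hqq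
  obtain ⟨m, hm⟩ := h.exists_placeOf_dense hi r l
  exact ⟨m, _, h1, h2, by rw [hm]; rfl⟩

end Construction

/-! ### Bad blocks are the only obstruction to local density -/

section Density

variable {act : ℕ → ℕ → ℕ → Bool}

/-- The order built from `act`. -/
noncomputable abbrev activationOrder (act : ℕ → ℕ → ℕ → Bool) : LinearOrder ℕ :=
  pullbackOrder (fun m => dyadicTriple (placeOf act m)) injective_dyadicTriple_placeOf

lemma activationOrder_lt {a b : ℕ} : (activationOrder act).lt a b ↔
    lexLt (dyadicTriple (placeOf act a)) (dyadicTriple (placeOf act b)) :=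
  pullbackOrder_lt

lemma IsActivation.triple_inv (h : IsActivation act) (m : ℕ) {X I : ℕ} {a : ℚ}
    (hm : dyadicTriple (placeOf act m) = (X, I, a)) :
    0 ≤ a ∧ (X % 2 = 0 → I % 2 = 0 → 0 < a) ∧ (X % 2 = 1 ∨ I % 2 = 1 → a = 0) ∧
      (X % 2 = 1 → I = 0) := by
  rcases h.triple_cases m with ⟨x, i, -, q, hq, hp⟩ | ⟨x, i, -, -, hp⟩ | ⟨x, hp⟩
  · rw [hp] at hm
    simp only [Prod.mk.injEq] at hm
    obtain ⟨rfl, rfl, rfl⟩ := hm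
    exact ⟨hq.le, fun _ _ => hq, by omega, by omega⟩
  · rw [hp] at hm
    simp only [dyadicTriple, Prod.mk.injEq, Nat.cast_zero, zero_div] at hm
    obtain ⟨rfl, rfl, rfl⟩ := hm
    exact ⟨le_rfl, by omega, fun _ => rfl, by omega⟩
  · rw [hp] at hm
    simp only [dyadicTriple, Prod.mk.injEq, Nat.cast_zero, zero_div] at hm
    obtain ⟨rfl, rfl, rfl⟩ := hm
    exact ⟨le_rfl, by omega, fun _ => rfl, by omega⟩

lemma lexLt_trans_of_not {a b c : ℕ × ℕ × ℚ} (h : ¬ lexLt b a) (h' : lexLt b c) : lexLt a c := by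
  rw [← toLex_lt_iff_lexLt] at h h' ⊢
  exact (not_lt.1 h).trans_lt h'

lemma lexLt_trans_of_not' {a b c : ℕ × ℕ × ℚ} (h : lexLt a b) (h' : ¬ lexLt c b) : lexLt a c := by
  rw [← toLex_lt_iff_lexLt] at h h' ⊢
  exact h.trans_le (not_lt.1 h')

/-- The tool for all density claims: it is enough to fit a nondegenerate rational interval of an
active section between `a` and `b`. -/
lemma IsActivation.exists_lexLt_between (h : IsActivation act) {x i : ℕ} (hi : IsActive act x i)
    {q q' : ℚ} (hq : 0 ≤ q) (hqq : q < q') {a b : ℕ × ℕ × ℚ} (ha : ¬ lexLt (2 * x, 2 * i, q) a)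
    (hb : ¬ lexLt b (2 * x, 2 * i, q')) :
    ∃ c, lexLt a (dyadicTriple (placeOf act c)) ∧ lexLt (dyadicTriple (placeOf act c)) b := by
  obtain ⟨c, t, h1, h2, hc⟩ := h.exists_between hi hq hqq
  refine ⟨c, ?_⟩
  rw [hc]
  exact ⟨lexLt_trans_of_not ha (by simp [lexLt, h1]),
    lexLt_trans_of_not' (by simp [lexLt, h2]) hb⟩

/-- The block `x` is bad if not all of its sections become active. -/
def IsBad (act : ℕ → ℕ → ℕ → Bool) (x : ℕ) : Prop := ∃ i, ¬ IsActive act x i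

lemma IsActivation.isActive_of_le (h : IsActivation act) {x i i' : ℕ} (hi : i' ≤ i) :
    IsActive act x i → IsActive act x i' :=
  fun ⟨k, hk⟩ => ⟨k, h.anti hi hk⟩

lemma IsActivation.exists_last (h : IsActivation act) {x : ℕ} (hx : IsBad act x) :
    ∃ i, i ≠ 0 ∧ IsActive act x i ∧ ∀ j, IsActive act x j → j ≤ i := by
  classical
  obtain ⟨i, hi, hmin⟩ : ∃ i, ¬ IsActive act x i ∧ ∀ j < i, IsActive act x j :=
    ⟨Nat.find hx, Nat.find_spec hx, fun j hj => not_not.1 (Nat.find_min hx hj)⟩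
  -- Sections 0 and 1 are always active, so the last active section is at least 1 and has a top
  -- point.
  have h0 : i ≠ 0 := fun h0 => hi (h0 ▸ ⟨0, h.zero x 0⟩)
  have h1 : i ≠ 1 := fun h1 => hi (h1 ▸ ⟨0, h.one x 0⟩)
  refine ⟨i - 1, by omega, hmin _ (by omega), fun j hj => ?_⟩
  by_contra hji
  exact hi (h.isActive_of_le (by omega) hj)

/-- A bad block has an adjacent pair of points, the upper one of which is its end. -/
lemma IsActivation.exists_adjacent (h : IsActivation act) {x : ℕ} (hx : IsBad act x) :
    ∃ a b, placeOf act b = (2 * x + 1, 0, 0, 0) ∧ (activationOrder act).lt a b ∧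
      ¬ ∃ c, (activationOrder act).lt a c ∧ (activationOrder act).lt c b := by
  obtain ⟨i, hi0, hi, hmax⟩ := h.exists_last hx
  obtain ⟨a, ha⟩ := h.exists_placeOf_top hi hi0
  obtain ⟨b, hb⟩ := h.exists_placeOf_end x
  refine ⟨a, b, hb, ?_, ?_⟩
  · rw [activationOrder_lt, ha, hb]
    simp [lexLt, dyadicTriple]
  · rintro ⟨c, hc, hc'⟩
    rw [activationOrder_lt, ha] at hc
    rw [activationOrder_lt, hb] at hc'
    rcases h.triple_cases c with ⟨y, j, hj, q, hq, hp⟩ | ⟨y, j, hj, -, hp⟩ | ⟨y, hp⟩ <;>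
    rw [hp] at hc hc' <;>
    simp only [lexLt, dyadicTriple, Nat.cast_zero, zero_div, lt_irrefl, and_false, or_false,
      not_lt_zero] at hc hc'
    · obtain rfl : y = x := by omega
      have := hmax j hj
      omega
    · obtain rfl : y = x := by omega
      have := hmax j hj
      omega
    · omega

/-- The order is locally dense off the points that bound an adjacent pair. -/
theorem IsActivation.locallyDenseOff (h : IsActivation act) :
    LocallyDenseOff (activationOrder act).lt {m | ∃ x, IsBad act x ∧
      (placeOf act m = (2 * x + 1, 0, 0, 0) ∨ ∃ i, ¬ IsActive act x (i + 1) ∧ IsActive act x i ∧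
        placeOf act m = (2 * x, 2 * i + 1, 0, 0))} := by
  intro m hm
  simp only [activationOrder_lt]
  have h0 : ∀ x, IsActive act x 0 := fun x => ⟨0, h.zero x 0⟩
  rcases h.triple_cases m with ⟨x, i, hi, q, hq, hp⟩ | ⟨x, i, hi, hi0, hp⟩ | ⟨x, hp⟩
  · rw [hp]
    refine ⟨?_, ?_, fun u hu => ?_, fun u hu => ?_⟩
    · obtain ⟨c, -, hc⟩ := h.exists_lexLt_between hi le_rfl hq (a := (2 * x, 2 * i, 0))
        (b := (2 * x, 2 * i, q)) (by simp [lexLt]) (by simp [lexLt])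
      exact ⟨c, hc⟩
    · obtain ⟨c, hc, -⟩ := h.exists_lexLt_between hi hq.le (lt_add_one q) (a := (2 * x, 2 * i, q))
        (b := (2 * x, 2 * i, q + 1)) (by simp [lexLt]) (by simp [lexLt])
      exact ⟨c, hc⟩
    · rcases hT : dyadicTriple (placeOf act u) with ⟨X, I, a⟩
      rw [hT] at hu
      obtain ⟨ha, -, -, -⟩ := h.triple_inv u hT
      by_cases hXI : X = 2 * x ∧ I = 2 * i
      · obtain ⟨rfl, rfl⟩ := hXI
        exact h.exists_lexLt_between hi ha (by simpa [lexLt] using hu) (by simp [lexLt])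
          (by simp [lexLt])
      · refine h.exists_lexLt_between hi le_rfl hq ?_ (by simp [lexLt])
        simp only [lexLt] at hu ⊢
        omega
    · rcases hT : dyadicTriple (placeOf act u) with ⟨X, I, a⟩
      rw [hT] at hu
      by_cases hXI : X = 2 * x ∧ I = 2 * i
      · obtain ⟨rfl, rfl⟩ := hXI
        exact h.exists_lexLt_between hi hq.le (by simpa [lexLt] using hu) (by simp [lexLt])
          (by simp [lexLt])
      · refine h.exists_lexLt_between hi hq.le (lt_add_one q) (by simp [lexLt]) ?_
        simp only [lexLt] at hu ⊢
        omega
  · have hi1 : IsActive act x (i + 1) := by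
      by_contra hcon
      exact hm ⟨x, ⟨i + 1, hcon⟩, Or.inr ⟨i, hcon, hi, hp⟩⟩
    rw [show dyadicTriple (placeOf act m) = (2 * x, 2 * i + 1, 0) by rw [hp]; simp [dyadicTriple] ]
    refine ⟨?_, ?_, fun u hu => ?_, fun u hu => ?_⟩
    · obtain ⟨c, -, hc⟩ := h.exists_lexLt_between hi le_rfl zero_lt_one (a := (2 * x, 2 * i, 0))
        (b := (2 * x, 2 * i + 1, 0)) (by simp [lexLt]) (by simp [lexLt])
      exact ⟨c, hc⟩
    · obtain ⟨c, hc, -⟩ := h.exists_lexLt_between hi1 le_rfl zero_lt_one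
        (a := (2 * x, 2 * i + 1, 0)) (b := (2 * x, 2 * (i + 1), 1)) (by simp [lexLt])
        (by simp [lexLt])
      exact ⟨c, hc⟩
    · rcases hT : dyadicTriple (placeOf act u) with ⟨X, I, a⟩
      rw [hT] at hu
      obtain ⟨ha, -, -, -⟩ := h.triple_inv u hT
      -- Anything below this top is at most `(2 * x, 2 * i, a)`, and section `i` is unbounded above
      -- that.
      refine h.exists_lexLt_between hi ha (lt_add_one a) ?_ (by simp [lexLt])
      simp only [lexLt, ha.not_gt, lt_irrefl, and_false, or_false] at hu ⊢
      omega
    · rcases hT : dyadicTriple (placeOf act u) with ⟨X, I, a⟩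
      rw [hT] at hu
      obtain ⟨-, ha, ha', -⟩ := h.triple_inv u hT
      by_cases hXI : X = 2 * x ∧ I = 2 * (i + 1)
      · obtain ⟨rfl, rfl⟩ := hXI
        exact h.exists_lexLt_between hi1 le_rfl (ha (by omega) (by omega))
          (by simp [lexLt]) (by simp [lexLt])
      · refine h.exists_lexLt_between hi1 le_rfl zero_lt_one (by simp [lexLt]) ?_
        simp only [lexLt] at hu ⊢
        have : ¬ (2 * x = X ∧ 2 * i + 1 = I ∧ 0 < a) := fun ⟨_, h2, h3⟩ =>
          h3.ne' (ha' (by omega))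
        grind
  · have hi : ∀ i, IsActive act x i := by
      by_contra! hcon
      exact hm ⟨x, hcon, Or.inl hp⟩
    rw [show dyadicTriple (placeOf act m) = (2 * x + 1, 0, 0) by rw [hp]; simp [dyadicTriple] ]
    refine ⟨?_, ?_, fun u hu => ?_, fun u hu => ?_⟩
    · obtain ⟨c, -, hc⟩ := h.exists_lexLt_between (h0 x) le_rfl zero_lt_one
        (a := (2 * x, 2 * 0, 0)) (b := (2 * x + 1, 0, 0)) (by simp [lexLt]) (by simp [lexLt])
      exact ⟨c, hc⟩
    · obtain ⟨c, hc, -⟩ := h.exists_lexLt_between (h0 (x + 1)) le_rfl zero_lt_one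
        (a := (2 * x + 1, 0, 0)) (b := (2 * (x + 1), 2 * 0, 1)) (by simp [lexLt])
        (by simp [lexLt])
      exact ⟨c, hc⟩
    · rcases hT : dyadicTriple (placeOf act u) with ⟨X, I, a⟩
      rw [hT] at hu
      obtain ⟨ha, -, -, -⟩ := h.triple_inv u hT
      -- Within block `x`, section `I + 1` has second coordinate `2 * (I + 1) > I`, hence lies above
      -- `u` and below the end.
      refine h.exists_lexLt_between (hi (I + 1)) le_rfl zero_lt_one ?_ (by simp [lexLt])
      simp only [lexLt, ha.not_gt, not_lt_zero, and_false, or_false] at hu ⊢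
      omega
    · rcases hT : dyadicTriple (placeOf act u) with ⟨X, I, a⟩
      rw [hT] at hu
      obtain ⟨-, ha, ha', hI⟩ := h.triple_inv u hT
      by_cases hXI : X = 2 * (x + 1) ∧ I = 2 * 0
      · obtain ⟨rfl, rfl⟩ := hXI
        exact h.exists_lexLt_between (h0 (x + 1)) le_rfl (ha (by omega) (by omega))
          (by simp [lexLt]) (by simp [lexLt])
      · refine h.exists_lexLt_between (h0 (x + 1)) le_rfl zero_lt_one (by simp [lexLt]) ?_
        simp only [lexLt] at hu ⊢
        have : 2 * x + 1 = X → ¬ 0 < a := fun h2 h3 => h3.ne' (ha' (by omega))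
        grind

theorem IsActivation.locallyDenseOff_empty_iff (h : IsActivation act) :
    LocallyDenseOff (activationOrder act).lt ∅ ↔ ∀ x i, IsActive act x i := by
  constructor
  · intro hd
    by_contra! hcon
    obtain ⟨x, hx⟩ := hcon
    obtain ⟨a, b, -, hab, hn⟩ := h.exists_adjacent hx
    exact hn ((hd b (Set.notMem_empty b)).2.2.1 a hab)
  · intro hall
    convert h.locallyDenseOff
    refine (Set.eq_empty_iff_forall_notMem.2 ?_).symm
    rintro m ⟨x, ⟨i, hi⟩, -⟩
    exact hi (hall x i)

/-- An exceptional set must contain the end of every bad block, these being distinct. Conversely, a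
bad block contributes only its end and its last top. -/
theorem IsActivation.exists_finite_iff (h : IsActivation act) :
    (∃ E : Set ℕ, E.Finite ∧ LocallyDenseOff (activationOrder act).lt E) ↔
      {x | IsBad act x}.Finite := by
  constructor
  · rintro ⟨E, hE, hd⟩
    choose f hf using h.exists_placeOf_end
    refine (hE.preimage (f := f) (Function.Injective.injOn fun x y hxy => ?_)).subset fun x hx => ?_
    · have := (hf x).symm.trans ((congrArg _ hxy).trans (hf y))
      simpa using this
    · obtain ⟨a, b, hb, hab, hn⟩ := h.exists_adjacent hx
      have : b = f x := injective_dyadicTriple_placeOf (congrArg dyadicTriple (hb.trans (hf x).symm))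
      by_contra hbE
      exact hn ((hd b (this ▸ hbE)).2.2.1 a hab)
  · intro hfin
    refine ⟨_, ?_, h.locallyDenseOff⟩
    choose! last _ hlast hmax using fun x (hx : IsBad act x) => h.exists_last hx
    have hinj : Function.Injective (placeOf act) :=
      Function.Injective.of_comp (f := dyadicTriple) injective_dyadicTriple_placeOf
    refine (((hfin.image fun x => (2 * x + 1, 0, 0, 0)).union
      (hfin.image fun x => (2 * x, 2 * last x + 1, 0, 0))).preimage
        (f := placeOf act) hinj.injOn).subset ?_
    rintro m ⟨x, hx, hm | ⟨i, hi, hi', hm⟩⟩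
    · exact Or.inl ⟨x, hx, hm.symm⟩
    · refine Or.inr ⟨x, hx, ?_⟩
      have h1 := hmax x hx i hi'
      have h2 : last x ≤ i := by
        by_contra hcon
        exact hi (h.isActive_of_le (by omega) (hlast x hx))
      rw [hm, le_antisymm h1 h2]

end Density

/-! ### Computability of the construction -/

section Computability

open Nat.Partrec (Code)
open Nat.Partrec.Code

/-- `f` is true at all numbers below a bound. -/
def allBelow (f : ℕ → Bool) (k : ℕ) : Bool :=
  Nat.rec true (fun j b => b && f j) k

lemma allBelow_eq_true {f : ℕ → Bool} {k : ℕ} : allBelow f k = true ↔ ∀ j < k, f j = true := by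
  induction k with
  | zero => simp [allBelow]
  | succ k ih =>
    change (allBelow f k && f k) = true ↔ _
    rw [Bool.and_eq_true, ih, Nat.forall_lt_succ_right]

lemma computable_allBelow {α : Type*} [Primcodable α] {f : α → ℕ → Bool} {g : α → ℕ}
    (hf : Computable₂ f) (hg : Computable g) : Computable fun a => allBelow (f a) (g a) :=
  Computable.nat_rec hg (Computable.const true)
    (Primrec.and.to_comp.comp (Computable.snd.comp Computable.snd)
      (hf.comp Computable.fst (Computable.fst.comp Computable.snd))).to₂

lemma computable_count {α : Type*} [Primcodable α] {f : α → ℕ → Bool} {g : α → ℕ}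
    (hf : Computable₂ f) (hg : Computable g) :
    Computable fun a => Nat.count (fun k => f a k = true) (g a) := by
  have h : Computable fun a => (Nat.rec 0 (fun j c => bif f a j then c + 1 else c) (g a) : ℕ) :=
    Computable.nat_rec hg (Computable.const 0)
      (Computable.cond (hf.comp Computable.fst (Computable.fst.comp Computable.snd))
        (Computable.succ.comp (Computable.snd.comp Computable.snd))
        (Computable.snd.comp Computable.snd)).to₂
  refine h.of_eq fun a => ?_
  induction g a with
  | zero => rfl
  | succ k ih =>
    rw [Nat.count_succ, ← ih]
    change (bif f a k then _ else _) = _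
    cases f a k <;> rfl

/-- Section `i` is active once every requirement `y < i - 1` has a witness. -/
def activation (R : ℕ × ℕ × ℕ × ℕ → Bool) (n x i k : ℕ) : Bool :=
  allBelow (fun y => !allBelow (fun z => !R (n, x, y, z)) k) (i - 1)

lemma activation_eq_true {R : ℕ × ℕ × ℕ × ℕ → Bool} {n x i k : ℕ} :
    activation R n x i k = true ↔ ∀ y < i - 1, ∃ z < k, R (n, x, y, z) = true := by
  rw [activation, allBelow_eq_true]
  refine forall₂_congr fun y _ => ?_
  rw [Bool.not_eq_true', ← Bool.not_eq_true, allBelow_eq_true]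
  simp

/-- Truncated subtraction leaves sections 0 and 1 without requirements. -/
lemma isActivation_activation (R : ℕ × ℕ × ℕ × ℕ → Bool) (n : ℕ) :
    IsActivation (activation R n) where
  zero x k := activation_eq_true.2 (by simp)
  one x k := activation_eq_true.2 (by simp)
  mono hk h := activation_eq_true.2 fun y hy => by
    obtain ⟨z, hz, hR⟩ := activation_eq_true.1 h y hy
    exact ⟨z, hz.trans_le hk, hR⟩
  anti hi h := activation_eq_true.2 fun y hy => activation_eq_true.1 h y (by omega)

lemma isActive_activation {R : ℕ × ℕ × ℕ × ℕ → Bool} {n x i : ℕ} :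
    IsActive (activation R n) x i ↔ ∀ y < i - 1, ∃ z, R (n, x, y, z) = true := by
  constructor
  · rintro ⟨k, hk⟩ y hy
    obtain ⟨z, -, hR⟩ := activation_eq_true.1 hk y hy
    exact ⟨z, hR⟩
  · intro h
    choose! f hf using h
    refine ⟨(Finset.range (i - 1)).sup f + 1, activation_eq_true.2 fun y hy =>
      ⟨f y, Nat.lt_succ_of_le (Finset.le_sup (f := f) (Finset.mem_range.2 hy)), hf y hy⟩⟩

lemma forall_isActive_activation {R : ℕ × ℕ × ℕ × ℕ → Bool} {n x : ℕ} :
    (∀ i, IsActive (activation R n) x i) ↔ ∀ y, ∃ z, R (n, x, y, z) = true :=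
  -- Section `y + 2` is the first to test requirement `y`.
  ⟨fun h y => isActive_activation.1 (h (y + 2)) y (by omega),
    fun h _ => isActive_activation.2 fun y _ => h y⟩

lemma computable_activation {R : ℕ × ℕ × ℕ × ℕ → Bool} (hR : Computable R) :
    Computable fun p : ℕ × ℕ × ℕ × ℕ => activation R p.1 p.2.1 p.2.2.1 p.2.2.2 := by
  have h3 : Computable fun q : ((ℕ × ℕ × ℕ × ℕ) × ℕ) × ℕ =>
      !R (q.1.1.1, q.1.1.2.1, q.1.2, q.2) :=
    Primrec.not.to_comp.comp (hR.comp
      ((Primrec.pair (Primrec.fst.comp (Primrec.fst.comp Primrec.fst))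
        (Primrec.pair (Primrec.fst.comp (Primrec.snd.comp (Primrec.fst.comp Primrec.fst)))
          (Primrec.pair (Primrec.snd.comp Primrec.fst) Primrec.snd))).to_comp))
  have h2 : Computable fun q : (ℕ × ℕ × ℕ × ℕ) × ℕ =>
      !allBelow (fun z => !R (q.1.1, q.1.2.1, q.2, z)) q.1.2.2.2 :=
    Primrec.not.to_comp.comp (computable_allBelow h3.to₂
      (Primrec.snd.comp (Primrec.snd.comp (Primrec.snd.comp Primrec.fst))).to_comp)
  exact computable_allBelow h2.to₂
    (Primrec.pred.comp (Primrec.fst.comp (Primrec.snd.comp Primrec.snd))).to_comp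

lemma primrec_place : Primrec fun p : (Bool × ℕ) × ℕ × ℕ × ℕ =>
    place p.1.1 p.1.2 p.2.1 p.2.2.1 p.2.2.2 := by
  have hb : Primrec fun p : (Bool × ℕ) × ℕ × ℕ × ℕ => p.1.1 := Primrec.fst.comp Primrec.fst
  have hc : Primrec fun p : (Bool × ℕ) × ℕ × ℕ × ℕ => p.1.2 := Primrec.snd.comp Primrec.fst
  have hx : Primrec fun p : (Bool × ℕ) × ℕ × ℕ × ℕ => p.2.1 := Primrec.fst.comp Primrec.snd
  have hi : Primrec fun p : (Bool × ℕ) × ℕ × ℕ × ℕ => p.2.2.1 :=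
    Primrec.fst.comp (Primrec.snd.comp Primrec.snd)
  have hk : Primrec fun p : (Bool × ℕ) × ℕ × ℕ × ℕ => p.2.2.2 :=
    Primrec.snd.comp (Primrec.snd.comp Primrec.snd)
  have c : ∀ {α : Type} [Primcodable α] (n : ℕ), Primrec fun _ : α => n := Primrec.const
  have dbl : ∀ {α : Type} [Primcodable α] {f : α → ℕ}, Primrec f → Primrec fun a => 2 * f a :=
    fun hf => Primrec.nat_mul.comp (c 2) hf
  have hj := Primrec.unpair.comp (Primrec.snd (α := (Bool × ℕ) × ℕ × ℕ × ℕ) (β := ℕ))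
  have hx' := hx.comp (Primrec.fst (α := (Bool × ℕ) × ℕ × ℕ × ℕ) (β := ℕ))
  have hi' := hi.comp (Primrec.fst (α := (Bool × ℕ) × ℕ × ℕ × ℕ) (β := ℕ))
  exact Primrec.cond hb
    (Primrec.nat_casesOn hc
      (Primrec.cond (Primrec.eq.comp hi (c 0)).decide
        ((Primrec.succ.comp (dbl hx)).pair ((c 0).pair ((c 0).pair (c 0))))
        ((dbl hx).pair ((Primrec.succ.comp (dbl hi)).pair ((c 0).pair (c 0)))))
      ((dbl hx').pair ((dbl hi').pair ((Primrec.succ.comp (dbl (Primrec.fst.comp hj))).pair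
        (Primrec.snd.comp hj)))))
    ((dbl hx).pair ((c 0).pair
      ((Primrec.nat_add.comp (dbl (Primrec₂.natPair.comp hi hk)) (c 2)).pair (c 0))))

lemma primrec_two_pow : Primrec fun n : ℕ => 2 ^ n := by
  have h : Primrec fun n : ℕ => (Nat.rec 1 (fun _ a => a * 2) n : ℕ) :=
    Primrec.nat_rec' Primrec.id (Primrec.const 1)
      (Primrec.nat_mul.comp (Primrec.snd.comp Primrec.snd) (Primrec.const 2)).to₂
  refine h.of_eq fun n => ?_
  induction n with
  | zero => rfl
  | succ n ih => rw [pow_succ, ← ih]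

lemma primrecPred_lexLt_dyadicTriple : PrimrecPred fun p : (ℕ × ℕ × ℕ × ℕ) × ℕ × ℕ × ℕ × ℕ =>
    lexLt (dyadicTriple p.1) (dyadicTriple p.2) := by
  simp only [lexLt_dyadicTriple]
  have s : ∀ {f : (ℕ × ℕ × ℕ × ℕ) × ℕ × ℕ × ℕ × ℕ → ℕ × ℕ × ℕ × ℕ}, Primrec f →
      Primrec (fun p => (f p).1) ∧ Primrec (fun p => (f p).2.1) ∧
      Primrec (fun p => (f p).2.2.1) ∧ Primrec (fun p => (f p).2.2.2) := fun hf =>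
    ⟨Primrec.fst.comp hf, Primrec.fst.comp (Primrec.snd.comp hf),
      Primrec.fst.comp (Primrec.snd.comp (Primrec.snd.comp hf)),
      Primrec.snd.comp (Primrec.snd.comp (Primrec.snd.comp hf))⟩
  obtain ⟨a1, a2, a3, a4⟩ := s Primrec.fst
  obtain ⟨b1, b2, b3, b4⟩ := s Primrec.snd
  exact (Primrec.nat_lt.comp a1 b1).or ((Primrec.eq.comp a1 b1).and
    ((Primrec.nat_lt.comp a2 b2).or ((Primrec.eq.comp a2 b2).and
      (Primrec.nat_lt.comp (Primrec.nat_mul.comp a3 (primrec_two_pow.comp b4))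
        (Primrec.nat_mul.comp b3 (primrec_two_pow.comp a4))))))

lemma computable_placeOf {act : ℕ → ℕ → ℕ → ℕ → Bool}
    (hact : Computable fun p : ℕ × ℕ × ℕ × ℕ => act p.1 p.2.1 p.2.2.1 p.2.2.2) :
    Computable fun p : ℕ × ℕ => placeOf (act p.1) p.2 := by
  have hx : Primrec fun p : ℕ × ℕ => p.2.unpair.1 :=
    Primrec.fst.comp (Primrec.unpair.comp Primrec.snd)
  have hik : Primrec fun p : ℕ × ℕ => p.2.unpair.2.unpair :=
    Primrec.unpair.comp (Primrec.snd.comp (Primrec.unpair.comp Primrec.snd))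
  have hi := Primrec.fst.comp hik
  have hk := Primrec.snd.comp hik
  have hb : Computable fun p : ℕ × ℕ =>
      act p.1 p.2.unpair.1 p.2.unpair.2.unpair.1 p.2.unpair.2.unpair.2 := by
    have h := (Primrec.fst.pair (hx.pair (hi.pair hk))).to_comp
    have h' := hact.comp h
    exact h'
  have hb' : Computable fun q : (ℕ × ℕ) × ℕ =>
      act q.1.1 q.1.2.unpair.1 q.1.2.unpair.2.unpair.1 q.2 := by
    have h : Primrec fun q : (ℕ × ℕ) × ℕ =>
        (q.1.1, q.1.2.unpair.1, q.1.2.unpair.2.unpair.1, q.2) :=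
      (Primrec.fst.comp Primrec.fst).pair ((hx.comp Primrec.fst).pair
        ((hi.comp Primrec.fst).pair Primrec.snd))
    have h' := hact.comp h.to_comp
    exact h'
  have hc := computable_count hb'.to₂ hk.to_comp
  have h := (hb.pair hc).pair (hx.pair (hi.pair hk)).to_comp
  have h' := primrec_place.to_comp.comp h
  exact h'

/-- A uniformly computable family of relations has a computable function of indices. -/
lemma exists_computable_index {f : ℕ → ℕ → ℕ} (hf : Computable₂ f) :
    ∃ g : ℕ → ℕ, Computable g ∧ ∀ n p, phi (g n) p = Part.some (f n p) := by
  have h : Computable fun q : ℕ => f q.unpair.1 q.unpair.2 :=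
    hf.comp (Computable.fst.comp Computable.unpair) (Computable.snd.comp Computable.unpair)
  -- The s-m-n theorem: `curry` fixes the parameter `n` in a code for the two-variable function.
  obtain ⟨c, hc⟩ := exists_code.1 (Partrec.nat_iff.1 h.partrec)
  refine ⟨fun n => Encodable.encode (curry c n), Computable.encode.comp
    (primrec₂_curry.comp (Primrec.const c) Primrec.id).to_comp, fun n p => ?_⟩
  rw [phi, Denumerable.ofNat_encode, eval_curry, hc]
  simp

lemma exists_computable_isIndexOf {act : ℕ → ℕ → ℕ → ℕ → Bool}
    (hact : Computable fun p : ℕ × ℕ × ℕ × ℕ => act p.1 p.2.1 p.2.2.1 p.2.2.2) :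
    ∃ g : ℕ → ℕ, Computable g ∧ ∀ n, IsIndexOf (g n) (activationOrder (act n)) := by
  classical
  have hp := computable_placeOf hact
  have h1 : Computable fun q : ℕ × ℕ => placeOf (act q.1) q.2.unpair.1 := by
    have h : Primrec fun q : ℕ × ℕ => (q.1, q.2.unpair.1) :=
      Primrec.fst.pair (Primrec.fst.comp (Primrec.unpair.comp Primrec.snd))
    have h' := hp.comp h.to_comp
    exact h'
  have h2 : Computable fun q : ℕ × ℕ => placeOf (act q.1) q.2.unpair.2 := by
    have h : Primrec fun q : ℕ × ℕ => (q.1, q.2.unpair.2) :=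
      Primrec.fst.pair (Primrec.snd.comp (Primrec.unpair.comp Primrec.snd))
    have h' := hp.comp h.to_comp
    exact h'
  have hlt : Computable fun q : ℕ × ℕ =>
      decide (lexLt (dyadicTriple (placeOf (act q.1) q.2.unpair.1))
        (dyadicTriple (placeOf (act q.1) q.2.unpair.2))) := by
    have h := primrecPred_lexLt_dyadicTriple.decide.to_comp.comp (h1.pair h2)
    exact h
  obtain ⟨g, hg, h⟩ := exists_computable_index
    (Computable.cond hlt (Computable.const 1) (Computable.const 0)).to₂
  refine ⟨g, hg, fun n a b => ?_⟩
  rw [h]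
  congr 1
  by_cases hab : (activationOrder (act n)).lt a b
  · refine Eq.trans ?_ (if_pos hab).symm
    simp [activationOrder_lt.1 hab]
  · refine Eq.trans ?_ (if_neg hab).symm
    simp [mt activationOrder_lt.2 hab]

/-! ### Reductions to the index sets -/

lemma IsIndexOf.lt_eq {e : ℕ} {lo lo' : LinearOrder ℕ} (h : IsIndexOf e lo)
    (h' : IsIndexOf e lo') : lo.lt = lo'.lt := by
  ext a b
  have := Part.some_inj.1 ((h a b).symm.trans (h' a b))
  by_cases h1 : lo.lt a b <;> by_cases h2 : lo'.lt a b
  · exact iff_of_true h1 h2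
  · exact absurd ((if_pos h1).symm.trans (this.trans (if_neg h2))) one_ne_zero
  · exact absurd ((if_neg h1).symm.trans (this.trans (if_pos h2))) zero_ne_one
  · exact iff_of_false h1 h2

theorem exists_reduction {R : ℕ × ℕ × ℕ × ℕ → Bool} (hR : Computable R) :
    ∃ g : ℕ → ℕ, Computable g ∧ ∀ n, g n ∈ LIN ∧
      (g n ∈ UHL ↔ ∀ x y, ∃ z, R (n, x, y, z) = true) ∧
      (g n ∈ WUL ↔ {x | ∃ y, ∀ z, R (n, x, y, z) = false}.Finite) := by
  obtain ⟨g, hg, h⟩ := exists_computable_isIndexOf (computable_activation hR)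
  refine ⟨g, hg, fun n => ⟨⟨_, h n⟩, ?_, ?_⟩⟩
  · rw [mem_UHL_iff, ← forall_congr' fun x => forall_isActive_activation,
      ← (isActivation_activation R n).locallyDenseOff_empty_iff]
    exact ⟨fun ⟨lo, hlo, hd⟩ => hlo.lt_eq (h n) ▸ hd, fun hd => ⟨_, h n, hd⟩⟩
  · have hbad : {x | ∃ y, ∀ z, R (n, x, y, z) = false} = {x | IsBad (activation R n) x} := by
      ext x
      have := not_congr (forall_isActive_activation (R := R) (n := n) (x := x))
      push Not at this
      simpa [IsBad] using this.symm
    rw [mem_WUL_iff, hbad, ← (isActivation_activation R n).exists_finite_iff]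
    exact ⟨fun ⟨lo, hlo, hd⟩ => hlo.lt_eq (h n) ▸ hd, fun hd => ⟨_, h n, hd⟩⟩

theorem exists_reduction_UHL {A : Set ℕ} (hA : IsPi02 A) :
    ∃ f : ℕ → ℕ, Computable f ∧ (∀ i, f i ∈ LIN) ∧ ∀ i, i ∈ A ↔ f i ∈ UHL := by
  obtain ⟨R, hR, hA⟩ := hA
  obtain ⟨r, hr, rfl⟩ := ComputablePred.computable_iff.1 hR
  -- All blocks are governed by the same requirements, so the block index is ignored.
  obtain ⟨g, hg, h⟩ := exists_reduction (R := fun p => r (p.1, p.2.2))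
    (hr.comp (Primrec.fst.pair (Primrec.snd.comp Primrec.snd)).to_comp)
  refine ⟨g, hg, fun i => (h i).1, fun i => ?_⟩
  rw [hA, (h i).2.1]
  simp

/-- Block `x` is to be good iff some `x' ≤ x` satisfies `∀ y, ∃ z`. The bounded quantifier moves
inside by letting `y` code a list of challenges, one for each `x'`, of which a single one has to be
met. A valid `x₀` makes all blocks from `x₀` on good; without one, every block is bad. -/
theorem exists_reduction_WUL {A : Set ℕ} (hA : IsSigma03 A) :
    ∃ f : ℕ → ℕ, Computable f ∧ (∀ i, f i ∈ LIN) ∧ ∀ i, i ∈ A ↔ f i ∈ WUL := by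
  obtain ⟨R, hR, hA⟩ := hA
  obtain ⟨r, hr, rfl⟩ := ComputablePred.computable_iff.1 hR
  have hx : Primrec fun p : ℕ × ℕ × ℕ × ℕ => p.2.1 := Primrec.fst.comp Primrec.snd
  have hl : Primrec fun p : ℕ × ℕ × ℕ × ℕ => listOfNat p.2.2.1 :=
    primrec_listOfNat.comp (Primrec.fst.comp (Primrec.snd.comp Primrec.snd))
  have hw : Primrec fun p : ℕ × ℕ × ℕ × ℕ => p.2.2.2.unpair :=
    Primrec.unpair.comp (Primrec.snd.comp (Primrec.snd.comp Primrec.snd))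
  have hw1 := Primrec.fst.comp hw
  have hR' : Computable fun p : ℕ × ℕ × ℕ × ℕ => decide (p.2.2.2.unpair.1 ≤ p.2.1) &&
      r (p.1, p.2.2.2.unpair.1, (listOfNat p.2.2.1).getD p.2.2.2.unpair.1 0,
        p.2.2.2.unpair.2) :=
    Primrec.and.to_comp.comp (Primrec.nat_le.comp hw1 hx).decide.to_comp
      (hr.comp (Primrec.fst.pair (hw1.pair (((Primrec.list_getD 0).comp hl hw1).pair
        (Primrec.snd.comp hw)))).to_comp)
  obtain ⟨g, hg, h⟩ := exists_reduction hR'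
  refine ⟨g, hg, fun i => (h i).1, fun i => ?_⟩
  rw [hA, (h i).2.2]
  constructor
  · rintro ⟨x₀, hx₀⟩
    refine (Set.finite_lt_nat x₀).subset fun x ⟨y, hy⟩ => ?_
    by_contra hx
    obtain ⟨z, hz⟩ := hx₀ ((listOfNat y).getD x₀ 0)
    have := hy (Nat.pair x₀ z)
    simp only [Nat.unpair_pair, Bool.and_eq_false_iff, decide_eq_false_iff_not] at this
    exact this.elim (fun h => h (not_lt.1 hx)) fun h => Bool.false_ne_true (h.symm.trans hz)
  · intro hfin
    by_contra! hcon
    choose Y hY using hcon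
    refine Set.infinite_univ (hfin.subset fun x _ => ?_)
    -- The list of failing challenges `Y 0, …, Y x` defeats all candidates up to `x` at once.
    obtain ⟨y, hy⟩ := listOfNat_surjective ((List.range (x + 1)).map Y)
    refine ⟨y, fun z => ?_⟩
    simp only [hy, Bool.and_eq_false_iff, decide_eq_false_iff_not]
    refine or_iff_not_imp_left.2 fun hz => ?_
    have hz : z.unpair.1 ≤ x := not_not.1 hz
    have hget : ((List.range (x + 1)).map Y).getD z.unpair.1 0 = Y z.unpair.1 := by
      simp [List.getD, Nat.lt_succ_of_le hz]
    rw [hget]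
    simpa using hY z.unpair.1 z.unpair.2

end Computability

lemma isCompleteRelativeTo_LIN {Γ : Set ℕ → Prop} {B : Set ℕ} (hB : Γ B) (hsub : B ⊆ LIN)
    (h : ∀ A, Γ A → ∃ f : ℕ → ℕ, Computable f ∧ (∀ i, f i ∈ LIN) ∧ ∀ i, i ∈ A ↔ f i ∈ B) :
    IsCompleteFor Γ B ∧ IsCompleteRelativeTo Γ B LIN :=
  ⟨⟨hB, fun A hA => (h A hA).imp fun _ hf => ⟨hf.1, hf.2.2⟩⟩,
    ⟨B, hB, (Set.inter_eq_left.2 hsub).symm⟩, h⟩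

theorem mainTheorem4 :
    (IsCompleteFor IsPi02 UHL ∧ IsCompleteRelativeTo IsPi02 UHL LIN) ∧
      (IsCompleteFor IsSigma03 WUL ∧ IsCompleteRelativeTo IsSigma03 WUL LIN) :=
  ⟨isCompleteRelativeTo_LIN isPi02_UHL (fun _ ⟨lo, h, _⟩ => ⟨lo, h⟩)
      fun _ => exists_reduction_UHL,
    isCompleteRelativeTo_LIN isSigma03_WUL (fun _ ⟨lo, h, _⟩ => ⟨lo, h⟩)
      fun _ => exists_reduction_WUL⟩
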